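/- Let $I,J$ be nonempty compact metric spaces and let $g,g^*:I\times J\to[-1,1]$ and $p^*:I\times J\to[0,1]$ be jointly continuous. In the associated absorbing game, at each stage $n=1,2,\dots$ at which absorption has not yet occurred, the players, knowing the past actions, simultaneously choose $i_n\in I$ and $j_n\in J$; the stage payoff is $g(i_n,j_n)$, and with probability $p^*(i_n,j_n)$ absorption is reached, in which case the payoff at all later stages is $g^*(i_n,j_n)$. For $\lambda\in(0,1]$ let $\Gamma_\lambda$ be the zero-sum game (Player 1 maximizes) with payoff the expectation of $\sum_{n\ge1}\lambda(1-\lambda)^{n-1}\,(\text{payoff at stage }n)$, and $v_\lambda$ its value. Let $X=\Delta(I)$, $Y=\Delta(J)$ be the sets of Borel probabilities, also viewed as the sets of stationary strategies. A stationary strategy is $\varepsilon$-optimal in $\Gamma_\lambda$ if it guarantees $v_\lambda$ up to $\varepsilon$ against all strategies of the opponent. For $(x,y)\in X\times Y$ let $c_n$ be the expected payoff at stage $n$ and $q_n$ the probability that absorption has not occurred before stage $n$, under $(x,y)$. Let $t_n=\lambda\sum_{i=1}^n(1-\lambda)^{i-1}$, and let $l^{x,y}_\lambda,Q^{x,y}_\lambda:[0,1]\to\mathbb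 R$ be the linear interpolations (extended continuously to $t=1$) of $$l^{x,y}_\lambda(t_n)=\lambda\sum_{i=1}^n(1-\lambda)^{i-1}c_i,\qquad Q^{x,y}_\lambda(t_n)=\lambda\sum_{i=1}^n(1-\lambda)^{i-1}q_i .$$ A function $l:[0,1]\to\mathbb R$ is a limit optimal trajectory for the payoff (LOTP) if for every $\varepsilon>0$ there is $\lambda_0>0$ such that for all $\lambda\in(0,\lambda_0)$ there are $\varepsilon$-optimal stationary strategies $x_\lambda,y_\lambda$ of Players 1 and 2 in $\Gamma_\lambda$ with $|l(t)-l^{x_\lambda,y_\lambda}_\lambda(t)|\le\varepsilon$ for all $t\in[0,1]$. A limit optimal trajectory $Q$ for the occupation measure of the nonabsorbing state (LOTM) is defined in the same way with $Q^{x_\lambda,y_\lambda}_\lambda$. Extend $g$, $p^*$ and $G^*:=p^*g^*$ bilinearly to $X\times Y$. Let ${\bf A}$ be the zero-sum game with strategy sets $X^2\times\mathbb R_+$ (maximizer) and $Y^2\times\mathbb R_+$ (minimizer) and payoff $$A(x,x',a,y,y',b)=\frac{g(x,y)+a\,G^*(x',y)+b\,G^*(x,y')}{1+a\,p^*(x',y)+b\,p^*(x,y')}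 .$$ **Proposition.** The value $v_\lambda$ exists for every $\lambda\in(0,1]$ and converges, as $\lambda\to0$, to some $v$, which is also the value of ${\bf A}$. There is $\gamma\in[0,+\infty]$ such that the function $Q(t)=\frac{1-(1-t)^{1+\gamma}}{1+\gamma}$ (read as $0$ when $\gamma=+\infty$) is a LOTM, and $l(t)=tv$ is a LOTP. Moreover the same strategies realise both: there are $x\in X$ and $y\in Y$ such that for every $\varepsilon>0$ there exist $x'\in X$, $a\ge0$, $y'\in Y$, $b\ge0$ with $(x,x',a)$ and $(y,y',b)$ $\varepsilon$-optimal in ${\bf A}$, and $\lambda_0>0$, such that for all $\lambda\in(0,\lambda_0)$ the stationary strategies $\hat x_\lambda=\frac{x+\lambda a x'}{1+\lambda a}$ and $\hat y_\lambda=\frac{y+\lambda b y'}{1+\lambda b}$ are $\varepsilon$-optimal in $\Gamma_\lambda$ and $$|Q(t)-Q^{\hat x_\lambda,\hat y_\lambda}_\lambda(t)|\le\varepsilon,\qquad |tv-l^{\hat x_\lambda,\hat y_\lambda}_\lambda(t)|\le\varepsilon\qquad\text{for all }t\in[0,1].$$ -/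

import Mathlib

open MeasureTheory ProbabilityTheory Filter Topology
open scoped NNReal ENNReal

/-- An absorbing game with action sets `I`, `J`: the stage payoff `g` before absorption, the
absorbing payoff `gs` (written `g*`) and the probability of absorption `ps` (written `p*`), all
jointly continuous. -/
structure AbsorbingGame (I J : Type*) [TopologicalSpace I] [TopologicalSpace J] where
  g : I → J → ℝ
  gs : I → J → ℝ
  ps : I → J → ℝ
  continuous_g : Continuous fun q : I × J => g q.1 q.2
  continuous_gs : Continuous fun q : I × J => gs q.1 q.2
  continuous_ps : Continuous fun q : I × J => ps q.1 q.2
  g_mem : ∀ i j, g i j ∈ Set.Icc (-1 : ℝ) 1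
  gs_mem : ∀ i j, gs i j ∈ Set.Icc (-1 : ℝ) 1
  ps_mem : ∀ i j, ps i j ∈ Set.Icc (0 : ℝ) 1

/-! ### Zero-sum games in normal form -/

/-- `v` is the value of the zero-sum game with payoff `u`, the first player maximizing. -/
def IsGameValue {S T : Type*} (u : S → T → ℝ) (v : ℝ) : Prop :=
  ∀ ε : ℝ, 0 < ε → (∃ s, ∀ t, v - ε ≤ u s t) ∧ (∃ t, ∀ s, u s t ≤ v + ε)

/-- `s` is an `ε`-optimal strategy of the maximizer in the game with payoff `u` and value `v`. -/
def IsEpsOptimalMax {S T : Type*} (u : S → T → ℝ) (v ε : ℝ) (s : S) : Prop :=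
  ∀ t, v - ε ≤ u s t

/-- `t` is an `ε`-optimal strategy of the minimizer in the game with payoff `u` and value `v`. -/
def IsEpsOptimalMin {S T : Type*} (u : S → T → ℝ) (v ε : ℝ) (t : T) : Prop :=
  ∀ s, u s t ≤ v + ε

/-! ### Strategies -/

/-- Behavior strategies of a player with action set `A`, when the players' action pairs lie in `H`:
after `n` stages without absorption, the next action is drawn according to a probability that
depends measurably on the past action pairs. -/
structure BehaviorStrategy (H A : Type*) [MeasurableSpace H] [MeasurableSpace A] where
  kernel : (n : ℕ) → Kernel (Fin n → H) A
  isMarkovKernel : ∀ n, IsMarkovKernel (kernel n)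

attribute [instance] BehaviorStrategy.isMarkovKernel

/-- The stationary strategy that draws the action according to `x` at each stage. -/
noncomputable def BehaviorStrategy.stationary (H : Type*) {A : Type*} [MeasurableSpace H]
    [MeasurableSpace A] (x : ProbabilityMeasure A) : BehaviorStrategy H A where
  kernel n := Kernel.const (Fin n → H) (x : Measure A)
  isMarkovKernel _ := inferInstance

/-- The mixed action `(x + c x') / (1 + c)`. -/
noncomputable def mixedCombination {A : Type*} [MeasurableSpace A] (x x' : ProbabilityMeasure A)
    (c : ℝ≥0) : ProbabilityMeasure A :=
  ⟨(1 + c)⁻¹ • ((x : Measure A) + c • (x' : Measure A)), ⟨by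
    have h : (1 + c : ℝ≥0) ≠ 0 := by positivity
    have h2 : ((1 + c : ℝ≥0) : ℝ≥0∞) = 1 + (c : ℝ≥0∞) := by simp
    simp only [Measure.smul_apply, Measure.add_apply, measure_univ, ENNReal.smul_def, smul_eq_mul,
      mul_one]
    rw [← h2, ← ENNReal.coe_mul, inv_mul_cancel₀ h, ENNReal.coe_one]⟩⟩

/-- The mixed action `(x + lam a x') / (1 + lam a)` for `lam ≥ 0`. -/
noncomputable def hatStrategy {A : Type*} [MeasurableSpace A] (x x' : ProbabilityMeasure A)
    (a : ℝ≥0) (lam : ℝ) : ProbabilityMeasure A :=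
  mixedCombination x x' (lam.toNNReal * a)

/-! ### Time normalization -/

/-- The date `t_n` at which the `n`-th stage ends, in the game with discount factor `lam`. -/
noncomputable def stageDate (lam : ℝ) (n : ℕ) : ℝ :=
  lam * ∑ i ∈ Finset.range n, (1 - lam) ^ i

/-- The trajectory accumulated up to time `t ∈ [0,1]` by the sequence `u` (`u n` being the quantity
at stage `n + 1`): stage `n + 1` contributes `u n` times the time it spent in `[0, t]`.
This is the linear interpolation between the dates `t_n` of the values
`lam * ∑ i ∈ Finset.range n, (1 - lam) ^ i * u i`, see the three lemmas below. -/
noncomputable def trajectory (lam : ℝ) (u : ℕ → ℝ) (t : ℝ) : ℝ :=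
  ∑' n : ℕ, (min t (stageDate lam (n + 1)) - min t (stageDate lam n)) * u n

lemma stageDate_succ (lam : ℝ) (n : ℕ) :
    stageDate lam (n + 1) = stageDate lam n + lam * (1 - lam) ^ n := by
  simp [stageDate, Finset.sum_range_succ, mul_add]

lemma stageDate_mono {lam : ℝ} (h0 : 0 ≤ lam) (h1 : lam ≤ 1) : Monotone (stageDate lam) := by
  refine monotone_nat_of_le_succ fun n => ?_
  rw [stageDate_succ]
  have := mul_nonneg h0 (pow_nonneg (sub_nonneg.2 h1) n)
  linarith

lemma stageDate_eq (lam : ℝ) (n : ℕ) : stageDate lam n = 1 - (1 - lam) ^ n := by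
  induction n with
  | zero => simp [stageDate]
  | succ n ih => rw [stageDate_succ, ih]; ring

/-- The interpolation on the interval between two consecutive dates. -/
lemma trajectory_of_mem_Icc {lam : ℝ} (h0 : 0 ≤ lam) (h1 : lam ≤ 1) (u : ℕ → ℝ) (n : ℕ) {t : ℝ}
    (ht : t ∈ Set.Icc (stageDate lam n) (stageDate lam (n + 1))) :
    trajectory lam u t =
      lam * ∑ i ∈ Finset.range n, (1 - lam) ^ i * u i + (t - stageDate lam n) * u n := by
  have hm := stageDate_mono h0 h1
  rw [trajectory, tsum_eq_sum (s := Finset.range (n + 1)), Finset.sum_range_succ, Finset.mul_sum,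
    min_eq_left ht.2, min_eq_right ht.1]
  · congr 1
    refine Finset.sum_congr rfl fun i hi => ?_
    have hi : i < n := Finset.mem_range.1 hi
    rw [min_eq_right ((hm hi).trans ht.1), min_eq_right ((hm hi.le).trans ht.1), stageDate_succ]
    ring
  · intro m hmn
    have hmn : n + 1 ≤ m := by simpa using hmn
    rw [min_eq_left (ht.2.trans (hm hmn)), min_eq_left (ht.2.trans (hm (hmn.trans m.le_succ)))]
    simp

/-- The value at the dates. -/
lemma trajectory_stageDate {lam : ℝ} (h0 : 0 ≤ lam) (h1 : lam ≤ 1) (u : ℕ → ℝ) (n : ℕ) :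
    trajectory lam u (stageDate lam n) = lam * ∑ i ∈ Finset.range n, (1 - lam) ^ i * u i := by
  rw [trajectory_of_mem_Icc h0 h1 u n ⟨le_rfl, stageDate_mono h0 h1 n.le_succ⟩]
  simp

/-- The value at the end of the game. -/
lemma trajectory_one {lam : ℝ} (h1 : lam ≤ 1) (u : ℕ → ℝ) :
    trajectory lam u 1 = ∑' n : ℕ, lam * (1 - lam) ^ n * u n := by
  refine tsum_congr fun n => ?_
  have h : ∀ m, stageDate lam m ≤ 1 := fun m => by
    rw [stageDate_eq]
    have := pow_nonneg (sub_nonneg.2 h1) m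
    linarith
  rw [min_eq_right (h _), min_eq_right (h _), stageDate_succ]
  ring

/-- The limit trajectory `(1 - (1 - t) ^ (1 + γ)) / (1 + γ)`, equal to `0` for `γ = ∞`. -/
noncomputable def limitOccupation (γ : ℝ≥0∞) (t : ℝ) : ℝ :=
  if γ = ∞ then 0 else (1 - (1 - t) ^ (1 + γ.toReal)) / (1 + γ.toReal)

/-! ### The repeated game -/

namespace AbsorbingGame

variable {I J : Type*} [TopologicalSpace I] [MeasurableSpace I]
  [TopologicalSpace J] [MeasurableSpace J]

/-- The law of the first `n` action pairs restricted to the event that absorption has not occurred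
during the first `n` stages. -/
noncomputable def historyLaw (G : AbsorbingGame I J) (σ : BehaviorStrategy (I × J) I)
    (τ : BehaviorStrategy (I × J) J) : (n : ℕ) → Measure (Fin n → I × J)
  | 0 => Measure.dirac Fin.elim0
  | n + 1 =>
    (((G.historyLaw σ τ n).compProd (Kernel.prod (σ.kernel n) (τ.kernel n))).withDensity
      fun q => ENNReal.ofReal (1 - G.ps q.2.1 q.2.2)).map
        fun q => Fin.snoc (α := fun _ => I × J) q.1 q.2

/-- The law of the past and of the action pair of stage `n + 1`, restricted to the event that
absorption has not occurred during the first `n` stages. -/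
noncomputable def playLaw (G : AbsorbingGame I J) (σ : BehaviorStrategy (I × J) I)
    (τ : BehaviorStrategy (I × J) J) (n : ℕ) : Measure ((Fin n → I × J) × (I × J)) :=
  (G.historyLaw σ τ n).compProd (Kernel.prod (σ.kernel n) (τ.kernel n))

/-- The probability that the game is in the nonabsorbing state at stage `n + 1`. -/
noncomputable def nonabsorbedProb (G : AbsorbingGame I J) (σ : BehaviorStrategy (I × J) I)
    (τ : BehaviorStrategy (I × J) J) (n : ℕ) : ℝ :=
  (G.historyLaw σ τ n).real Set.univ

/-- The expected payoff at stage `n + 1`: that of the nonabsorbing state, plus, for each earlier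
stage `m + 1`, the absorbing payoff on the event that absorption occurs at that stage. -/
noncomputable def stagePayoff (G : AbsorbingGame I J) (σ : BehaviorStrategy (I × J) I)
    (τ : BehaviorStrategy (I × J) J) (n : ℕ) : ℝ :=
  (∫ q, G.g q.2.1 q.2.2 ∂(G.playLaw σ τ n)) +
    ∑ m ∈ Finset.range n, ∫ q, G.ps q.2.1 q.2.2 * G.gs q.2.1 q.2.2 ∂(G.playLaw σ τ m)

/-- The payoff of the game with discount factor `lam ∈ (0,1]`. -/
noncomputable def discountedPayoff (G : AbsorbingGame I J) (lam : ℝ)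
    (σ : BehaviorStrategy (I × J) I) (τ : BehaviorStrategy (I × J) J) : ℝ :=
  ∑' n : ℕ, lam * (1 - lam) ^ n * G.stagePayoff σ τ n

/-- The value of the game with discount factor `lam ∈ (0,1]`. -/
noncomputable def discountedValue (G : AbsorbingGame I J) (lam : ℝ) : ℝ :=
  ⨆ σ, ⨅ τ, G.discountedPayoff lam σ τ

/-- The stationary strategies of Player 1 that are `ε`-optimal in the discounted game (against all
strategies of Player 2). -/
def EpsOptimalStationary₁ (G : AbsorbingGame I J) (lam ε : ℝ) : Set (ProbabilityMeasure I) :=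
  {x | IsEpsOptimalMax (G.discountedPayoff lam) (G.discountedValue lam) ε (.stationary _ x)}

/-- The stationary strategies of Player 2 that are `ε`-optimal in the discounted game (against all
strategies of Player 1). -/
def EpsOptimalStationary₂ (G : AbsorbingGame I J) (lam ε : ℝ) : Set (ProbabilityMeasure J) :=
  {y | IsEpsOptimalMin (G.discountedPayoff lam) (G.discountedValue lam) ε (.stationary _ y)}

/-! ### Limit optimal trajectories -/

/-- The expected accumulated payoff up to time `t` under stationary strategies. -/
noncomputable def payoffTrajectory (G : AbsorbingGame I J) (lam : ℝ) (x : ProbabilityMeasure I)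
    (y : ProbabilityMeasure J) (t : ℝ) : ℝ :=
  trajectory lam (G.stagePayoff (.stationary _ x) (.stationary _ y)) t

/-- The expected accumulated occupation of the nonabsorbing state up to time `t` under stationary
strategies. -/
noncomputable def occupationTrajectory (G : AbsorbingGame I J) (lam : ℝ)
    (x : ProbabilityMeasure I) (y : ProbabilityMeasure J) (t : ℝ) : ℝ :=
  trajectory lam (G.nonabsorbedProb (.stationary _ x) (.stationary _ y)) t

/-- `l` is a limit optimal trajectory for the expected accumulated payoff. -/
def IsLOTP (G : AbsorbingGame I J) (l : ℝ → ℝ) : Prop :=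
  ∀ ε : ℝ, 0 < ε → ∃ lam₀ ∈ Set.Ioc (0 : ℝ) 1, ∀ lam ∈ Set.Ioo 0 lam₀,
    ∃ x ∈ G.EpsOptimalStationary₁ lam ε, ∃ y ∈ G.EpsOptimalStationary₂ lam ε,
      ∀ t ∈ Set.Icc (0 : ℝ) 1, |l t - G.payoffTrajectory lam x y t| ≤ ε

/-- `Q` is a limit optimal trajectory for the expected accumulated occupation measure (of the
nonabsorbing state). -/
def IsLOTM (G : AbsorbingGame I J) (Q : ℝ → ℝ) : Prop :=
  ∀ ε : ℝ, 0 < ε → ∃ lam₀ ∈ Set.Ioc (0 : ℝ) 1, ∀ lam ∈ Set.Ioo 0 lam₀,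
    ∃ x ∈ G.EpsOptimalStationary₁ lam ε, ∃ y ∈ G.EpsOptimalStationary₂ lam ε,
      ∀ t ∈ Set.Icc (0 : ℝ) 1, |Q t - G.occupationTrajectory lam x y t| ≤ ε

/-! ### The auxiliary game -/

/-- The bilinear extension of `f` to mixed actions. -/
noncomputable def bilinearExt (f : I → J → ℝ) (x : ProbabilityMeasure I)
    (y : ProbabilityMeasure J) : ℝ :=
  ∫ q, f q.1 q.2 ∂((x : Measure I).prod (y : Measure J))

/-- The payoff `A(x,x',a,y,y',b)` of the auxiliary game, where `s = (x,x',a)`, `t = (y,y',b)`. -/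
noncomputable def auxPayoff (G : AbsorbingGame I J)
    (s : ProbabilityMeasure I × ProbabilityMeasure I × ℝ≥0)
    (t : ProbabilityMeasure J × ProbabilityMeasure J × ℝ≥0) : ℝ :=
  (bilinearExt G.g s.1 t.1
      + s.2.2 * bilinearExt (fun i j => G.ps i j * G.gs i j) s.2.1 t.1
      + t.2.2 * bilinearExt (fun i j => G.ps i j * G.gs i j) s.1 t.2.1) /
    (1 + s.2.2 * bilinearExt G.ps s.2.1 t.1 + t.2.2 * bilinearExt G.ps s.1 t.2.1)

end AbsorbingGame

/-!
Fix `w` and consider the one-shot game with discount factor `lam` and continuation payoff `w`. By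
the minimax theorem (`exists_forall_integral_pos_or_exists_forall_integral_nonpos`) either the
maximizer guarantees more than `w` in it or the minimizer guarantees at most `w`. The payoff of
the repeated game minus `w` is the discounted sum of the expected one-shot excesses over `w`
(`AbsorbingGame.hasSum_integral_excess`), so a mixed action that is good in the one-shot game is,
played at each stage, good against all behavior strategies. The discounted value `v_lam` is the
threshold in `w` at which the alternative switches
(`AbsorbingGame.exists_isGameValue_discountedPayoff`).

Let `lam` go to `0` along an ultrafilter, so that almost optimal stationary strategies `x_lam`,
`y_lam` and the values `v_lam` have limits `x`, `y`, `v`. Dividing the one-shot inequality for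
`x_lam` by `lam` shows that `(x, x_lam, (1 - lam) / lam)` guarantees almost `v` in the auxiliary
game, and likewise for the minimizer. Thus `v` is the value of the auxiliary game whatever the
ultrafilter, and `v_lam` converges to it (`AbsorbingGame.exists_tendsto_discountedValue`). In
addition `G*(x, ·) ≥ v p*(x, ·)` and `G*(·, y) ≤ v p*(·, y)`.

Conversely, let `(x, x', a)` and `(y, y', b)`, with these `x` and `y`, be `ε`-optimal in the
auxiliary game. The one-shot payoff of `x + lam a x'` against `y` is close to that of
`(x, x', a)` against `(y, y, (1 - lam) / lam)`, whence its optimality in the discounted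
game. Under the two perturbed strategies the distance of the accumulated payoff to `t v` is, for
all `t`, at most, with `g`, `p*` and `G*` taken at these strategies,
`(lam |g - v| + (1 - lam) |G* - v p*|) / (lam + (1 - lam) p*)`
(`AbsorbingGame.abs_mul_sub_payoffTrajectory_le`). If `p*(x, y) > 0` this tends to `0` because
`G*(x, y) = v p*(x, y)`. If `p*(x, y) = 0` its limit is at most `3 ε`, since each player may drop
its own perturbation (`AbsorbingGame.abs_add_abs_le_of_epsOptimal`). The probability of absorption
at a stage is `lam (a p*(x', y) + b p*(x, y')) + o(lam)` in the second case and is of larger order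
than `lam` in the first; this determines the limit of the occupation of the nonabsorbing state,
with a rate that depends on `ε`. The rate `γ` is a limit point in `[0, ∞]` of the rates for
`ε → 0`, and the limit occupation is continuous in the rate, uniformly in time.
-/

/-! ### Bilinear extensions -/

namespace AbsorbingGame

section Algebra

variable {I J : Type*} [MeasurableSpace I] [MeasurableSpace J]

lemma bilinearExt_const_mul (c : ℝ) (f : I → J → ℝ) (x : ProbabilityMeasure I)
    (y : ProbabilityMeasure J) :
    bilinearExt (fun i j => c * f i j) x y = c * bilinearExt f x y :=
  integral_const_mul _ _

lemma bilinearExt_const (c : ℝ) (x : ProbabilityMeasure I) (y : ProbabilityMeasure J) :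
    bilinearExt (fun _ _ => c) x y = c := by
  simp [bilinearExt]

lemma bilinearExt_neg (f : I → J → ℝ) (x : ProbabilityMeasure I)
    (y : ProbabilityMeasure J) :
    bilinearExt (fun i j => -f i j) x y = -bilinearExt f x y :=
  integral_neg _

end Algebra

section Bilinear

variable {I J : Type*} [MetricSpace I] [CompactSpace I] [MeasurableSpace I] [BorelSpace I]
  [MetricSpace J] [CompactSpace J] [MeasurableSpace J] [BorelSpace J]

lemma integrable_of_continuous {f : I → J → ℝ} (hf : Continuous fun q : I × J => f q.1 q.2)
    (μ : Measure (I × J)) [IsFiniteMeasure μ] : Integrable (fun q : I × J => f q.1 q.2) μ :=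
  hf.integrable_of_hasCompactSupport (HasCompactSupport.of_compactSpace _)

lemma bilinearExt_eq_integral_integral {f : I → J → ℝ}
    (hf : Continuous fun q : I × J => f q.1 q.2) (x : ProbabilityMeasure I)
    (y : ProbabilityMeasure J) :
    bilinearExt f x y = ∫ i, ∫ j, f i j ∂(y : Measure J) ∂(x : Measure I) :=
  integral_prod _ (integrable_of_continuous hf _)

lemma bilinearExt_eq_integral_integral_swap {f : I → J → ℝ}
    (hf : Continuous fun q : I × J => f q.1 q.2) (x : ProbabilityMeasure I)
    (y : ProbabilityMeasure J) :
    bilinearExt f x y = ∫ j, ∫ i, f i j ∂(x : Measure I) ∂(y : Measure J) :=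
  integral_prod_symm _ (integrable_of_continuous hf _)

lemma bilinearExt_swap (f : I → J → ℝ) (x : ProbabilityMeasure I) (y : ProbabilityMeasure J) :
    bilinearExt (fun j i => f i j) y x = bilinearExt f x y :=
  integral_prod_swap (fun q : I × J => f q.1 q.2)

lemma bilinearExt_add {f h : I → J → ℝ} (hf : Continuous fun q : I × J => f q.1 q.2)
    (hh : Continuous fun q : I × J => h q.1 q.2) (x : ProbabilityMeasure I)
    (y : ProbabilityMeasure J) :
    bilinearExt (fun i j => f i j + h i j) x y = bilinearExt f x y + bilinearExt h x y :=
  integral_add (integrable_of_continuous hf _) (integrable_of_continuous hh _)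

lemma bilinearExt_sub {f h : I → J → ℝ} (hf : Continuous fun q : I × J => f q.1 q.2)
    (hh : Continuous fun q : I × J => h q.1 q.2) (x : ProbabilityMeasure I)
    (y : ProbabilityMeasure J) :
    bilinearExt (fun i j => f i j - h i j) x y = bilinearExt f x y - bilinearExt h x y :=
  integral_sub (integrable_of_continuous hf _) (integrable_of_continuous hh _)

lemma bilinearExt_mono {f h : I → J → ℝ} (hf : Continuous fun q : I × J => f q.1 q.2)
    (hh : Continuous fun q : I × J => h q.1 q.2) (hfh : ∀ i j, f i j ≤ h i j)
    (x : ProbabilityMeasure I) (y : ProbabilityMeasure J) :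
    bilinearExt f x y ≤ bilinearExt h x y :=
  integral_mono (integrable_of_continuous hf _) (integrable_of_continuous hh _)
    fun q => hfh q.1 q.2

lemma continuous_bilinearExt {f : I → J → ℝ} (hf : Continuous fun q : I × J => f q.1 q.2) :
    Continuous fun z : ProbabilityMeasure I × ProbabilityMeasure J => bilinearExt f z.1 z.2 := by
  let F : BoundedContinuousFunction (I × J) ℝ :=
    BoundedContinuousFunction.mkOfCompact ⟨fun q : I × J => f q.1 q.2, hf⟩
  have h := ProbabilityMeasure.continuous_prod (α := I) (β := J)
  rw [continuous_iff_continuousAt] at h ⊢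
  intro z
  exact ProbabilityMeasure.tendsto_iff_forall_integral_tendsto.1 (h z) F

/-- Weak convergence of one mixed action makes the payoff converge uniformly in the mixed action of
the opponent, by compactness of the latter's set of mixed actions. -/
lemma eventually_forall_abs_bilinearExt_sub_le {f : I → J → ℝ}
    (hf : Continuous fun q : I × J => f q.1 q.2) {α : Type*} {l : Filter α}
    {u : α → ProbabilityMeasure I} {x : ProbabilityMeasure I} (hu : Tendsto u l (𝓝 x))
    {ε : ℝ} (hε : 0 < ε) :
    ∀ᶠ k in l, ∀ y : ProbabilityMeasure J, |bilinearExt f (u k) y - bilinearExt f x y| ≤ ε := by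
  let F : C(ProbabilityMeasure I × ProbabilityMeasure J, ℝ) :=
    ⟨fun z => bilinearExt f z.1 z.2, continuous_bilinearExt hf⟩
  have h : Tendsto (fun k => F.curry (u k)) l (𝓝 (F.curry x)) :=
    (F.curry.continuous.tendsto x).comp hu
  filter_upwards [Metric.tendsto_nhds.1 h ε hε] with k hk y
  have := (ContinuousMap.dist_apply_le_dist (f := F.curry (u k)) (g := F.curry x) y).trans hk.le
  simpa [F, Real.dist_eq] using this

lemma bilinearExt_mixedCombination_left {f : I → J → ℝ}
    (hf : Continuous fun q : I × J => f q.1 q.2) (x x' : ProbabilityMeasure I)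
    (c : ℝ≥0) (y : ProbabilityMeasure J) :
    (1 + c) * bilinearExt f (mixedCombination x x' c) y =
      bilinearExt f x y + c * bilinearExt f x' y := by
  have h : ((1 + c : ℝ≥0) : ℝ) ≠ 0 := by positivity
  have hi : ∀ x : ProbabilityMeasure I,
      Integrable (fun i => ∫ j, f i j ∂(y : Measure J)) (x : Measure I) := fun x =>
    (integrable_of_continuous hf ((x : Measure I).prod (y : Measure J))).integral_prod_left
  simp only [bilinearExt_eq_integral_integral hf]
  have : ((mixedCombination x x' c : ProbabilityMeasure I) : Measure I) =
    (1 + c)⁻¹ • ((x : Measure I) + c • (x' : Measure I)) := rfl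
  rw [this, integral_smul_nnreal_measure, integral_add_measure (hi x) ((hi x').smul_measure_nnreal),
    integral_smul_nnreal_measure]
  simp only [NNReal.smul_def, smul_eq_mul, NNReal.coe_inv]
  push_cast at h ⊢
  field_simp

lemma bilinearExt_mixedCombination_right {f : I → J → ℝ}
    (hf : Continuous fun q : I × J => f q.1 q.2) (x : ProbabilityMeasure I)
    (c : ℝ≥0) (y y' : ProbabilityMeasure J) :
    (1 + c) * bilinearExt f x (mixedCombination y y' c) =
      bilinearExt f x y + c * bilinearExt f x y' := by
  have hf' : Continuous fun q : J × I => f q.2 q.1 := hf.comp continuous_swap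
  simpa only [bilinearExt_swap f] using
    bilinearExt_mixedCombination_left (f := fun j i => f i j) hf' y y' c x

end Bilinear

section Basic

variable {I J : Type*} [TopologicalSpace I] [TopologicalSpace J] (G : AbsorbingGame I J)

/-- The absorbing payoff weighted by the probability of absorption, `G* = p* g*`. -/
def Gs (i : I) (j : J) : ℝ := G.ps i j * G.gs i j

/-- The game with the roles of the players exchanged. -/
def swap : AbsorbingGame J I where
  g j i := -G.g i j
  gs j i := -G.gs i j
  ps j i := G.ps i j
  continuous_g := (G.continuous_g.comp continuous_swap).neg
  continuous_gs := (G.continuous_gs.comp continuous_swap).neg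
  continuous_ps := G.continuous_ps.comp continuous_swap
  g_mem j i := by have := G.g_mem i j; exact ⟨by linarith [this.2], by linarith [this.1]⟩
  gs_mem j i := by have := G.gs_mem i j; exact ⟨by linarith [this.2], by linarith [this.1]⟩
  ps_mem j i := G.ps_mem i j

/-- The excess, over the constant payoff `w`, of the payoff `lam g + (1 - lam) (p* g* + (1 - p*) w)`
of the one-shot game with discount factor `lam` and continuation payoff `w`. -/
def excess (lam w : ℝ) (i : I) (j : J) : ℝ :=
  lam * (G.g i j - w) + (1 - lam) * (G.Gs i j - w * G.ps i j)

lemma continuous_Gs : Continuous fun q : I × J => G.Gs q.1 q.2 :=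
  G.continuous_ps.mul G.continuous_gs

lemma continuous_excess (lam w : ℝ) : Continuous fun q : I × J => G.excess lam w q.1 q.2 :=
  ((G.continuous_g.sub continuous_const).const_mul _).add
    ((G.continuous_Gs.sub (G.continuous_ps.const_mul _)).const_mul _)

lemma abs_Gs_le (i : I) (j : J) : |G.Gs i j| ≤ G.ps i j := by
  have h := abs_le.2 (G.gs_mem i j)
  rw [Gs, abs_mul, abs_of_nonneg (G.ps_mem i j).1]
  exact mul_le_of_le_one_right (G.ps_mem i j).1 h

/-- The condition `0 ≤ excess` becomes stronger as `w` increases. -/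
lemma excess_antitone {lam : ℝ} (h0 : 0 ≤ lam) (h1 : lam ≤ 1) (i : I) (j : J) :
    Antitone fun w => G.excess lam w i j := by
  intro w w' h
  have h2 := mul_nonneg (sub_nonneg.2 h1) (mul_nonneg (sub_nonneg.2 h) (G.ps_mem i j).1)
  have h3 := mul_nonneg h0 (sub_nonneg.2 h)
  simp only [excess]
  nlinarith

end Basic

section Bounds

variable {I J : Type*} [MetricSpace I] [CompactSpace I] [MeasurableSpace I] [BorelSpace I]
  [MetricSpace J] [CompactSpace J] [MeasurableSpace J] [BorelSpace J] (G : AbsorbingGame I J)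

lemma abs_bilinearExt_g_le (x : ProbabilityMeasure I) (y : ProbabilityMeasure J) :
    |bilinearExt G.g x y| ≤ 1 := by
  refine abs_le.2 ⟨?_, ?_⟩
  · simpa [bilinearExt_const] using bilinearExt_mono (f := fun _ _ => (-1 : ℝ)) continuous_const
      G.continuous_g (fun i j => (G.g_mem i j).1) x y
  · simpa [bilinearExt_const] using bilinearExt_mono (h := fun _ _ => (1 : ℝ))
      G.continuous_g continuous_const (fun i j => (G.g_mem i j).2) x y

lemma bilinearExt_ps_mem (x : ProbabilityMeasure I) (y : ProbabilityMeasure J) :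
    bilinearExt G.ps x y ∈ Set.Icc (0 : ℝ) 1 := by
  refine ⟨?_, ?_⟩
  · simpa [bilinearExt_const] using bilinearExt_mono (f := fun _ _ => (0 : ℝ)) continuous_const
      G.continuous_ps (fun i j => (G.ps_mem i j).1) x y
  · simpa [bilinearExt_const] using bilinearExt_mono (h := fun _ _ => (1 : ℝ))
      G.continuous_ps continuous_const (fun i j => (G.ps_mem i j).2) x y

lemma abs_bilinearExt_Gs_le (x : ProbabilityMeasure I) (y : ProbabilityMeasure J) :
    |bilinearExt G.Gs x y| ≤ bilinearExt G.ps x y := by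
  refine abs_le.2 ⟨?_, ?_⟩
  · rw [← bilinearExt_neg]
    exact bilinearExt_mono G.continuous_ps.neg G.continuous_Gs
      (fun i j => (abs_le.1 (G.abs_Gs_le i j)).1) x y
  · exact bilinearExt_mono G.continuous_Gs G.continuous_ps
      (fun i j => (abs_le.1 (G.abs_Gs_le i j)).2) x y

lemma bilinearExt_excess (lam w : ℝ) (x : ProbabilityMeasure I) (y : ProbabilityMeasure J) :
    bilinearExt (G.excess lam w) x y = lam * (bilinearExt G.g x y - w) +
      (1 - lam) * (bilinearExt G.Gs x y - w * bilinearExt G.ps x y) := by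
  have hps := G.continuous_ps.const_mul w
  have h1 := (G.continuous_g.sub (continuous_const (y := w))).const_mul lam
  have h2 := (G.continuous_Gs.sub hps).const_mul (1 - lam)
  change bilinearExt (fun i j => lam * (G.g i j - w) + (1 - lam) * (G.Gs i j - w * G.ps i j))
    x y = _
  rw [bilinearExt_add h1 h2, bilinearExt_const_mul, bilinearExt_const_mul,
    bilinearExt_sub G.continuous_g continuous_const, bilinearExt_sub G.continuous_Gs hps,
    bilinearExt_const_mul, bilinearExt_const]

end Bounds

end AbsorbingGame

/-! ### A minimax theorem -/

section Minimax

/-- A positive linear functional on `C(J, ℝ)`, positive at the constant `1`, is a positive multiple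
of the integral against a probability measure. -/
lemma exists_probabilityMeasure_integral_eq {J : Type*} [TopologicalSpace J] [T2Space J]
    [CompactSpace J] [MeasurableSpace J] [BorelSpace J] (L : C(J, ℝ) →ₗ[ℝ] ℝ)
    (hL : ∀ φ : C(J, ℝ), (∀ j, 0 ≤ φ j) → 0 ≤ L φ) (hL1 : 0 < L 1) :
    ∃ y : ProbabilityMeasure J, ∀ φ : C(J, ℝ), L φ = L 1 * ∫ j, φ j ∂(y : Measure J) := by
  let Lc : CompactlySupportedContinuousMap J ℝ →ₗ[ℝ] ℝ :=
    { toFun := fun f => L f.toContinuousMap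
      map_add' := fun f h => L.map_add _ _
      map_smul' := fun c f => L.map_smul _ _ }
  let Λ : CompactlySupportedContinuousMap J ℝ →ₚ[ℝ] ℝ :=
    PositiveLinearMap.mk₀ Lc fun f hf => hL _ fun j => hf j
  set μ := RealRMK.rieszMeasure Λ
  have hμ : ∀ φ : C(J, ℝ), ∫ j, φ j ∂μ = L φ := fun φ =>
    RealRMK.integral_rieszMeasure Λ (CompactlySupportedContinuousMap.continuousMapEquiv φ)
  have hfin : IsFiniteMeasure μ := ⟨isCompact_univ.measure_lt_top⟩
  have huniv : μ.real Set.univ = L 1 := by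
    rw [← hμ 1]; simp
  have hne : μ Set.univ ≠ 0 := by
    intro h
    rw [Measure.real, h] at huniv
    simp at huniv
    linarith
  refine ⟨⟨(μ Set.univ)⁻¹ • μ, ⟨?_⟩⟩, fun φ => ?_⟩
  · rw [Measure.smul_apply, smul_eq_mul, ENNReal.inv_mul_cancel hne (measure_ne_top _ _)]
  · change _ = L 1 * ∫ j, φ j ∂((μ Set.univ)⁻¹ • μ)
    rw [integral_smul_measure, hμ, ENNReal.toReal_inv, ← huniv]
    have : μ.real Set.univ ≠ 0 := by rw [huniv]; exact hL1.ne'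
    change _ = μ.real Set.univ * ((μ.real Set.univ)⁻¹ • _)
    rw [smul_eq_mul, mul_inv_cancel_left₀ this]

/-- The minimax theorem for the mixed extension of a continuous game, as an alternative: either the
maximizer has a mixed action whose payoff is positive against all actions, or the minimizer has a
mixed action whose payoff is nonpositive against all actions. If the first fails, the convex set of
the payoffs `∫ i, f i · ∂x` is separated from the open convex cone of positive functions, and the
separating functional is the mixed action of the minimizer. -/
theorem exists_forall_integral_pos_or_exists_forall_integral_nonpos {I J : Type*}
    [MetricSpace I] [CompactSpace I] [Nonempty I] [MeasurableSpace I] [BorelSpace I]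
    [MetricSpace J] [CompactSpace J] [MeasurableSpace J] [BorelSpace J]
    {f : I → J → ℝ} (hf : Continuous fun q : I × J => f q.1 q.2) :
    (∃ x : ProbabilityMeasure I, ∀ j, 0 < ∫ i, f i j ∂(x : Measure I)) ∨
      ∃ y : ProbabilityMeasure J, ∀ i, ∫ j, f i j ∂(y : Measure J) ≤ 0 := by
  refine or_iff_not_imp_left.2 fun hno => ?_
  have hcont : ∀ x : ProbabilityMeasure I, Continuous fun j => ∫ i, f i j ∂(x : Measure I) := by
    intro x
    have hi : ∀ j, ∫ i, f i j ∂(x : Measure I) = AbsorbingGame.bilinearExt f x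
        ((diracProba j : ProbabilityMeasure J)) := by
      intro j
      rw [AbsorbingGame.bilinearExt_eq_integral_integral_swap hf]
      simp [diracProba]
    simp_rw [hi]
    exact (AbsorbingGame.continuous_bilinearExt hf).comp
      (continuous_const.prodMk continuous_diracProba)
  have hint : ∀ (x : ProbabilityMeasure I) (j : J),
      Integrable (fun i => f i j) (x : Measure I) := fun x j =>
    (hf.comp (continuous_id.prodMk continuous_const)).integrable_of_hasCompactSupport
      (HasCompactSupport.of_compactSpace _)
  let Φ : ProbabilityMeasure I → C(J, ℝ) := fun x => ⟨_, hcont x⟩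
  let s : Set C(J, ℝ) := {φ | ∀ j, 0 < φ j}
  have hs : s = {φ : C(J, ℝ) | Set.MapsTo φ Set.univ (Set.Ioi 0)} := by
    ext φ; simp [s, Set.MapsTo]
  have hsopen : IsOpen s := by
    rw [hs]
    exact ContinuousMap.isOpen_setOfPred_mapsTo isCompact_univ isOpen_Ioi
  have hsconv : Convex ℝ s := by
    intro φ hφ ψ hψ a b ha hb hab j
    have : 0 < a * φ j + b * ψ j := by
      rcases ha.eq_or_lt with rfl | ha
      · have : b = 1 := by linarith
        simpa [this] using hψ j
      · exact add_pos_of_pos_of_nonneg (mul_pos ha (hφ j)) (mul_nonneg hb (hψ j).le)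
    simpa using this
  have htconv : Convex ℝ (Set.range Φ) := by
    rintro _ ⟨x, rfl⟩ _ ⟨x', rfl⟩ a b ha hb hab
    lift a to ℝ≥0 using ha
    lift b to ℝ≥0 using hb
    have hab' : (a : ℝ≥0∞) + b = 1 := by exact_mod_cast hab
    refine ⟨⟨a • (x : Measure I) + b • (x' : Measure I), ⟨?_⟩⟩, ?_⟩
    · rw [Measure.add_apply, Measure.smul_apply, Measure.smul_apply, measure_univ, measure_univ,
        ENNReal.smul_def, ENNReal.smul_def, smul_eq_mul, smul_eq_mul, mul_one, mul_one, hab']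
    · ext j
      change ∫ i, f i j ∂(a • (x : Measure I) + b • (x' : Measure I)) = _
      rw [integral_add_measure (hint x j).smul_measure_nnreal (hint x' j).smul_measure_nnreal,
        integral_smul_nnreal_measure, integral_smul_nnreal_measure]
      rfl
  have hdisj : Disjoint s (Set.range Φ) := by
    rw [Set.disjoint_left]
    rintro _ hφ ⟨x, rfl⟩
    exact hno ⟨x, hφ⟩
  obtain ⟨ℓ, u, hℓs, hℓt⟩ := geometric_hahn_banach_open hsconv hsopen htconv hdisj
  have hsmul : ∀ φ ∈ s, ∀ c : ℝ, 0 < c → c * ℓ φ < u := by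
    intro φ hφ c hc
    have := hℓs (c • φ) fun j => by simpa using mul_pos hc (hφ j)
    simpa using this
  have hone : (1 : C(J, ℝ)) ∈ s := fun j => one_pos
  -- The set of positive functions is a cone with `0` in its closure.
  have hu : 0 ≤ u := by
    have h : Tendsto (fun c : ℝ => c * ℓ 1) (𝓝[>] 0) (𝓝 0) := by
      have : Tendsto (fun c : ℝ => c * ℓ 1) (𝓝 0) (𝓝 (0 * ℓ 1)) := tendsto_id.mul_const _
      rw [zero_mul] at this
      exact this.mono_left nhdsWithin_le_nhds
    exact le_of_tendsto h (eventually_mem_nhdsWithin.mono fun c hc => (hsmul 1 hone c hc).le)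
  have hneg : ∀ φ ∈ s, ℓ φ ≤ 0 := by
    intro φ hφ
    by_contra! h
    have h1 := hsmul φ hφ ((u + 1) / ℓ φ) (div_pos (by linarith) h)
    rw [div_mul_cancel₀ _ h.ne'] at h1
    linarith
  have hpos : ∀ φ : C(J, ℝ), (∀ j, 0 ≤ φ j) → 0 ≤ (-ℓ) φ := by
    intro φ hφ
    have h : Tendsto (fun c : ℝ => ℓ φ + c * ℓ 1) (𝓝[>] 0) (𝓝 (ℓ φ)) := by
      have : Tendsto (fun c : ℝ => ℓ φ + c * ℓ 1) (𝓝 0) (𝓝 (ℓ φ + 0 * ℓ 1)) :=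
        (tendsto_id.mul_const _).const_add _
      rw [zero_mul, add_zero] at this
      exact this.mono_left nhdsWithin_le_nhds
    have : ℓ φ ≤ 0 := le_of_tendsto h (eventually_mem_nhdsWithin.mono fun c hc => by
      have := hneg (φ + c • 1) fun j => by
        simpa using add_pos_of_nonneg_of_pos (hφ j) hc
      simpa using this)
    simpa using this
  have hℓ1 : 0 < (-ℓ) 1 := by
    refine (hpos 1 fun _ => zero_le_one).lt_of_ne fun h => ?_
    have hz : ∀ φ : C(J, ℝ), 0 ≤ ℓ φ := by
      intro φ
      have := hpos (‖φ‖ • 1 - φ) fun j => by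
        have := (le_abs_self (φ j)).trans (φ.norm_coe_le_norm j)
        simpa using this
      have h1 : ℓ 1 = 0 := by simpa using h.symm
      simpa [h1] using this
    obtain ⟨i₀⟩ := ‹Nonempty I›
    have h1 : ℓ 1 = 0 := by simpa using h.symm
    have h2 := hℓs 1 hone
    have h3 := hℓt _ ⟨diracProba i₀, rfl⟩
    have hz' : ∀ φ : C(J, ℝ), ℓ φ ≤ 0 := fun φ => by simpa using hz (-φ)
    linarith [hz' (Φ (diracProba i₀))]
  obtain ⟨y, hy⟩ := exists_probabilityMeasure_integral_eq (-ℓ : StrongDual ℝ C(J, ℝ)).toLinearMap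
    hpos hℓ1
  refine ⟨y, fun i => ?_⟩
  have h1 := hy (Φ (diracProba i))
  have h2 := hℓt _ ⟨diracProba i, rfl⟩
  have h3 : ∀ j, Φ (diracProba i) j = f i j := fun j => by
    change ∫ i, f i j ∂(Measure.dirac i) = _
    simp
  simp only [h3] at h1
  by_contra! h4
  have h5 : 0 < (-ℓ) 1 * ∫ j, f i j ∂(y : Measure J) := mul_pos hℓ1 h4
  have h6 : (-ℓ) (Φ (diracProba i)) = (-ℓ) 1 * ∫ j, f i j ∂(y : Measure J) := h1
  rw [← h6] at h5
  simp only [neg_apply] at h5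
  linarith

end Minimax

/-! ### Discounted sums -/

section DiscountedSums

lemma summable_mul_of_abs_le_one {f : ℕ → ℝ} (hf : Summable f) {u : ℕ → ℝ}
    (hu : ∀ n, |u n| ≤ 1) : Summable fun n => f n * u n := by
  refine Summable.of_norm_bounded hf.norm fun n => ?_
  rw [norm_mul, Real.norm_eq_abs (u n)]
  exact mul_le_of_le_one_right (norm_nonneg _) (hu n)

lemma hasSum_telescope {a : ℕ → ℝ} (ha : Summable a) :
    HasSum (fun n => a n - a (n + 1)) (a 0) := by
  have h := (hasSum_nat_add_iff' 1).2 ha.hasSum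
  simpa using ha.hasSum.sub h

lemma abs_one_sub_lt_one {lam : ℝ} (h0 : 0 < lam) (h1 : lam ≤ 1) : ‖1 - lam‖ < 1 := by
  rw [Real.norm_eq_abs, abs_lt]
  constructor <;> linarith

lemma abs_sum_range_le {e : ℕ → ℝ} (he : ∀ n, |e n| ≤ 1) (n : ℕ) :
    |∑ m ∈ Finset.range n, e m| ≤ n := by
  refine (Finset.abs_sum_le_sum_abs _ _).trans ((Finset.sum_le_sum fun m _ => he m).trans ?_)
  simp

lemma summable_pow_mul_sum_range {lam : ℝ} (h0 : 0 < lam) (h1 : lam ≤ 1) {e : ℕ → ℝ}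
    (he : ∀ n, |e n| ≤ 1) :
    Summable fun n => (1 - lam) ^ n * ∑ m ∈ Finset.range n, e m := by
  refine Summable.of_norm_bounded
    (summable_pow_mul_geometric_of_norm_lt_one 1 (abs_one_sub_lt_one h0 h1)) fun n => ?_
  have hr : 0 ≤ (1 - lam) ^ n := pow_nonneg (by linarith) n
  rw [Real.norm_eq_abs, abs_mul, abs_of_nonneg hr, pow_one, mul_comm]
  exact mul_le_mul_of_nonneg_right (abs_sum_range_le he n) hr

/-- Summation by parts: a quantity `e m` received at each stage after stage `m + 1` has discounted
weight `(1 - lam) ^ (m + 1)`. -/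
lemma hasSum_discounted_sum_range {lam : ℝ} (h0 : 0 < lam) (h1 : lam ≤ 1) {e : ℕ → ℝ}
    (he : ∀ n, |e n| ≤ 1) :
    HasSum (fun n => lam * (1 - lam) ^ n * ∑ m ∈ Finset.range n, e m)
      (∑' m, (1 - lam) ^ (m + 1) * e m) := by
  have ha := hasSum_telescope (summable_pow_mul_sum_range h0 h1 he)
  have hb : Summable fun m => (1 - lam) ^ (m + 1) * e m := by
    refine summable_mul_of_abs_le_one ?_ he
    simpa [pow_succ] using
      (summable_geometric_of_norm_lt_one (abs_one_sub_lt_one h0 h1)).mul_right (1 - lam)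
  have := ha.add hb.hasSum
  simp only [Finset.range_zero, Finset.sum_empty, mul_zero, zero_add] at this
  refine this.congr_fun fun n => ?_
  rw [Finset.sum_range_succ]
  ring

lemma summable_discount {lam : ℝ} (h0 : 0 < lam) (h1 : lam ≤ 1) :
    Summable fun n => (1 - lam) ^ n :=
  summable_geometric_of_norm_lt_one (abs_one_sub_lt_one h0 h1)

end DiscountedSums

/-! ### The value of a zero-sum game -/

lemma IsGameValue.unique {S T : Type*} {u : S → T → ℝ} {v w : ℝ} (hv : IsGameValue u v)
    (hw : IsGameValue u w) : v = w := by
  have key : ∀ {v w : ℝ}, IsGameValue u v → IsGameValue u w → v ≤ w := by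
    intro v w hv hw
    refine le_of_forall_pos_le_add fun ε hε => ?_
    obtain ⟨⟨s, hs⟩, -⟩ := hv (ε / 2) (half_pos hε)
    obtain ⟨-, ⟨t, ht⟩⟩ := hw (ε / 2) (half_pos hε)
    linarith [hs t, ht s]
  exact le_antisymm (key hv hw) (key hw hv)

/-- The value of a game with bounded payoff is its maxmin. -/
lemma IsGameValue.iSup_iInf_eq {S T : Type*} {u : S → T → ℝ} {v C : ℝ}
    (hv : IsGameValue u v) (hu : ∀ s t, |u s t| ≤ C) : ⨆ s, ⨅ t, u s t = v := by
  obtain ⟨⟨s₀, -⟩, ⟨t₀, -⟩⟩ := hv 1 one_pos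
  have : Nonempty S := ⟨s₀⟩
  have : Nonempty T := ⟨t₀⟩
  have hbelow : ∀ s, BddBelow (Set.range (u s)) := fun s =>
    ⟨-C, by rintro _ ⟨t, rfl⟩; exact (abs_le.1 (hu s t)).1⟩
  have habove : BddAbove (Set.range fun s => ⨅ t, u s t) :=
    ⟨C, by rintro _ ⟨s, rfl⟩; exact (ciInf_le (hbelow s) t₀).trans (abs_le.1 (hu s t₀)).2⟩
  refine le_antisymm (le_of_forall_pos_le_add fun ε hε => ?_)
    (le_of_forall_sub_le fun ε hε => ?_)
  · obtain ⟨-, ⟨t, ht⟩⟩ := hv ε hε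
    exact ciSup_le fun s => (ciInf_le (hbelow s) t).trans (ht s)
  · obtain ⟨⟨s, hs⟩, -⟩ := hv ε hε
    exact (le_ciInf hs).trans (le_ciSup habove s)

/-! ### The payoff of the repeated game -/

namespace AbsorbingGame

lemma measurable_snoc {H : Type*} [MeasurableSpace H] (n : ℕ) :
    Measurable fun q : (Fin n → H) × H =>
      (Fin.snoc (α := fun _ => H) q.1 q.2 : Fin (n + 1) → H) := by
  refine measurable_pi_iff.2 fun k => ?_
  induction k using Fin.lastCases with
  | last => simpa using measurable_snd
  | cast k =>
    simpa [Function.comp_def] using (measurable_pi_apply (X := fun _ => H) k).comp measurable_fst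

/-- The mixed action prescribed by a behavior strategy after the history `h`. -/
noncomputable def _root_.BehaviorStrategy.mixedAction {H A : Type*} [MeasurableSpace H]
    [MeasurableSpace A] (σ : BehaviorStrategy H A) {n : ℕ} (h : Fin n → H) : ProbabilityMeasure A :=
  ⟨σ.kernel n h, inferInstance⟩

@[simp]
lemma _root_.BehaviorStrategy.mixedAction_stationary {H A : Type*} [MeasurableSpace H]
    [MeasurableSpace A] (x : ProbabilityMeasure A) {n : ℕ} (h : Fin n → H) :
    (BehaviorStrategy.stationary H x).mixedAction h = x := rfl

section General

variable {I J : Type*} [TopologicalSpace I] [MeasurableSpace I] [TopologicalSpace J]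
  [MeasurableSpace J] (G : AbsorbingGame I J) (σ : BehaviorStrategy (I × J) I)
  (τ : BehaviorStrategy (I × J) J)

lemma nonabsorbedProb_zero : G.nonabsorbedProb σ τ 0 = 1 := by
  simp [nonabsorbedProb, historyLaw]

lemma nonabsorbedProb_nonneg (n : ℕ) : 0 ≤ G.nonabsorbedProb σ τ n := measureReal_nonneg

lemma stagePayoff_eq (n : ℕ) : G.stagePayoff σ τ n = (∫ q, G.g q.2.1 q.2.2 ∂(G.playLaw σ τ n)) +
    ∑ m ∈ Finset.range n, ∫ q, G.Gs q.2.1 q.2.2 ∂(G.playLaw σ τ m) := rfl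

end General

variable {I J : Type*} [MetricSpace I] [CompactSpace I] [MeasurableSpace I] [BorelSpace I]
  [MetricSpace J] [CompactSpace J] [MeasurableSpace J] [BorelSpace J]

variable (G : AbsorbingGame I J) (σ : BehaviorStrategy (I × J) I) (τ : BehaviorStrategy (I × J) J)

lemma integrable_comp_snd {f : I → J → ℝ} (hf : Continuous fun q : I × J => f q.1 q.2)
    {H : Type*} [MeasurableSpace H] (μ : Measure (H × (I × J))) [IsFiniteMeasure μ] :
    Integrable (fun q => f q.2.1 q.2.2) μ := by
  obtain ⟨C, hC⟩ := isCompact_univ.exists_bound_of_continuousOn hf.continuousOn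
  exact Integrable.of_bound (hf.measurable.comp measurable_snd).aestronglyMeasurable C
    (Eventually.of_forall fun q => hC q.2 (Set.mem_univ _))

instance isFiniteMeasure_historyLaw (n : ℕ) : IsFiniteMeasure (G.historyLaw σ τ n) := by
  induction n with
  | zero => rw [historyLaw]; infer_instance
  | succ n ih =>
    rw [historyLaw]
    have : IsFiniteMeasure (G.playLaw σ τ n) := by rw [playLaw]; infer_instance
    have := isFiniteMeasure_withDensity_ofReal (integrable_comp_snd
      (f := fun i j => 1 - G.ps i j) (continuous_const.sub G.continuous_ps) (G.playLaw σ τ n)).2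
    change IsFiniteMeasure (((G.playLaw σ τ n).withDensity _).map _)
    infer_instance

instance isFiniteMeasure_playLaw (n : ℕ) : IsFiniteMeasure (G.playLaw σ τ n) := by
  rw [playLaw]; infer_instance

lemma playLaw_real_univ (n : ℕ) : (G.playLaw σ τ n).real Set.univ = G.nonabsorbedProb σ τ n := by
  rw [nonabsorbedProb, Measure.real, Measure.real, playLaw, Measure.compProd_apply_univ]

/-- The expectation of `f` at a stage is that of its bilinear extension at the mixed actions,
because the actions are independent given the past. -/
lemma integral_playLaw {f : I → J → ℝ} (hf : Continuous fun q : I × J => f q.1 q.2) (n : ℕ) :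
    ∫ q, f q.2.1 q.2.2 ∂(G.playLaw σ τ n) =
      ∫ h, bilinearExt f (σ.mixedAction h) (τ.mixedAction h) ∂(G.historyLaw σ τ n) := by
  rw [playLaw, Measure.integral_compProd (integrable_comp_snd hf _)]
  simp_rw [Kernel.prod_apply]
  rfl

lemma integral_playLaw_stationary {f : I → J → ℝ} (hf : Continuous fun q : I × J => f q.1 q.2)
    (x : ProbabilityMeasure I) (y : ProbabilityMeasure J) (n : ℕ) :
    ∫ q, f q.2.1 q.2.2 ∂(G.playLaw (.stationary _ x) (.stationary _ y) n) =
      G.nonabsorbedProb (.stationary _ x) (.stationary _ y) n * bilinearExt f x y := by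
  rw [integral_playLaw _ _ _ hf]
  simp [nonabsorbedProb]

lemma nonabsorbedProb_succ (n : ℕ) : G.nonabsorbedProb σ τ (n + 1) =
    G.nonabsorbedProb σ τ n - ∫ q, G.ps q.2.1 q.2.2 ∂(G.playLaw σ τ n) := by
  have hm : Measurable fun q : (Fin n → I × J) × (I × J) => 1 - G.ps q.2.1 q.2.2 :=
    ((continuous_const.sub G.continuous_ps).measurable).comp measurable_snd
  have h1 : G.nonabsorbedProb σ τ (n + 1) = ∫ q, (1 - G.ps q.2.1 q.2.2) ∂(G.playLaw σ τ n) := by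
    rw [integral_eq_lintegral_of_nonneg_ae
      (Eventually.of_forall fun q => sub_nonneg.2 (G.ps_mem _ _).2) hm.aestronglyMeasurable,
      nonabsorbedProb, Measure.real, historyLaw, Measure.map_apply (measurable_snoc n) .univ,
      Set.preimage_univ, withDensity_apply _ .univ, Measure.restrict_univ]
    rfl
  rw [h1, integral_sub (integrable_const _) (integrable_comp_snd G.continuous_ps _),
    integral_const, playLaw_real_univ, smul_eq_mul, mul_one]

lemma nonabsorbedProb_le_one (n : ℕ) : G.nonabsorbedProb σ τ n ≤ 1 := by
  induction n with
  | zero => rw [nonabsorbedProb_zero]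
  | succ n ih =>
    rw [nonabsorbedProb_succ]
    have : 0 ≤ ∫ q, G.ps q.2.1 q.2.2 ∂(G.playLaw σ τ n) :=
      integral_nonneg fun q => (G.ps_mem _ _).1
    linarith

lemma abs_integral_playLaw_le {f : I → J → ℝ} (hb : ∀ i j, |f i j| ≤ 1) (n : ℕ) :
    |∫ q, f q.2.1 q.2.2 ∂(G.playLaw σ τ n)| ≤ 1 := by
  have h := norm_integral_le_of_norm_le_const (μ := G.playLaw σ τ n)
    (f := fun q => f q.2.1 q.2.2) (C := 1) (Eventually.of_forall fun q => hb _ _)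
  rw [playLaw_real_univ, one_mul] at h
  exact h.trans (G.nonabsorbedProb_le_one σ τ n)

/-- The payoff of the discounted game exceeds `w` by the discounted sum of the expected one-stage
excesses. -/
lemma hasSum_integral_excess {lam : ℝ} (h0 : 0 < lam) (h1 : lam ≤ 1) (w : ℝ) :
    HasSum (fun n => (1 - lam) ^ n * ∫ q, G.excess lam w q.2.1 q.2.2 ∂(G.playLaw σ τ n))
      (G.discountedPayoff lam σ τ - w) := by
  set eg : ℕ → ℝ := fun n => ∫ q, G.g q.2.1 q.2.2 ∂(G.playLaw σ τ n) with heg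
  set eG : ℕ → ℝ := fun n => ∫ q, G.Gs q.2.1 q.2.2 ∂(G.playLaw σ τ n) with heG
  have hg : ∀ n, |eg n| ≤ 1 := G.abs_integral_playLaw_le σ τ fun i j => abs_le.2 (G.g_mem i j)
  have hG : ∀ n, |eG n| ≤ 1 := G.abs_integral_playLaw_le σ τ fun i j =>
    (G.abs_Gs_le i j).trans (G.ps_mem i j).2
  have hq : ∀ n, |G.nonabsorbedProb σ τ n| ≤ 1 := fun n => by
    rw [abs_of_nonneg (G.nonabsorbedProb_nonneg σ τ n)]
    exact G.nonabsorbedProb_le_one σ τ n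
  have hd := summable_discount h0 h1
  have s1 : Summable fun n => lam * (1 - lam) ^ n * eg n :=
    summable_mul_of_abs_le_one (hd.mul_left lam) hg
  have s2 := hasSum_discounted_sum_range h0 h1 hG
  have s2' : Summable fun n => (1 - lam) ^ (n + 1) * eG n :=
    summable_mul_of_abs_le_one ((summable_nat_add_iff 1).2 hd) hG
  have s3 := hasSum_telescope (summable_mul_of_abs_le_one hd hq)
  have h : G.discountedPayoff lam σ τ =
      (∑' n, lam * (1 - lam) ^ n * eg n) + ∑' n, (1 - lam) ^ (n + 1) * eG n := by
    rw [← (s1.hasSum.add s2).tsum_eq]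
    refine tsum_congr fun n => ?_
    rw [stagePayoff_eq, mul_add]
  have h3 := (s1.hasSum.add s2'.hasSum).sub (s3.mul_left w)
  rw [← h, nonabsorbedProb_zero] at h3
  simp only [pow_zero, mul_one] at h3
  refine h3.congr_fun fun n => ?_
  have hexc : ∫ q, G.excess lam w q.2.1 q.2.2 ∂(G.playLaw σ τ n) =
      lam * (eg n - w * G.nonabsorbedProb σ τ n) +
      (1 - lam) * (eG n - w * (G.nonabsorbedProb σ τ n - G.nonabsorbedProb σ τ (n + 1))) := by
    have ig := integrable_comp_snd G.continuous_g (G.playLaw σ τ n)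
    have iG := integrable_comp_snd G.continuous_Gs (G.playLaw σ τ n)
    have ip := integrable_comp_snd G.continuous_ps (G.playLaw σ τ n)
    have ic : Integrable (fun _ => w) (G.playLaw σ τ n) := integrable_const _
    simp only [excess]
    have i1 : Integrable (fun q => lam * (G.g q.2.1 q.2.2 - w)) (G.playLaw σ τ n) :=
      (ig.sub ic).const_mul _
    have i2 : Integrable (fun q => (1 - lam) * (G.Gs q.2.1 q.2.2 - w * G.ps q.2.1 q.2.2))
        (G.playLaw σ τ n) := (iG.sub (ip.const_mul _)).const_mul _
    rw [integral_add i1 i2, integral_const_mul, integral_const_mul, integral_sub ig ic,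
      integral_sub iG (ip.const_mul _), integral_const_mul, integral_const,
      playLaw_real_univ, nonabsorbedProb_succ]
    simp only [smul_eq_mul, heg, heG]
    ring
  rw [hexc]
  ring

lemma abs_discountedPayoff_le {lam : ℝ} (h0 : 0 < lam) (h1 : lam ≤ 1) :
    |G.discountedPayoff lam σ τ| ≤ 1 := by
  have hr : ∀ n, 0 ≤ (1 - lam) ^ n := fun n => pow_nonneg (by linarith) n
  refine abs_le.2 ⟨?_, ?_⟩
  · have h := (G.hasSum_integral_excess σ τ h0 h1 (-1)).nonneg fun n => mul_nonneg (hr n)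
      (integral_nonneg fun q => by
        have h2 := (G.g_mem q.2.1 q.2.2).1
        have h3 := (abs_le.1 (G.abs_Gs_le q.2.1 q.2.2)).1
        exact add_nonneg (mul_nonneg h0.le (by linarith)) (mul_nonneg (by linarith) (by linarith)))
    linarith
  · have h := (G.hasSum_integral_excess σ τ h0 h1 1).nonpos fun n =>
      mul_nonpos_of_nonneg_of_nonpos (hr n) (integral_nonpos fun q => by
        have h2 := (G.g_mem q.2.1 q.2.2).2
        have h3 := (abs_le.1 (G.abs_Gs_le q.2.1 q.2.2)).2
        exact add_nonpos (mul_nonpos_of_nonneg_of_nonpos h0.le (by linarith))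
          (mul_nonpos_of_nonneg_of_nonpos (by linarith) (by linarith)))
    linarith

/-- A mixed action whose one-stage excess over `w` is nonnegative guarantees `w` to the maximizer
when it is played at each stage. -/
lemma le_discountedPayoff_stationary {lam : ℝ} (h0 : 0 < lam) (h1 : lam ≤ 1) {w : ℝ}
    {x : ProbabilityMeasure I} (hx : ∀ y, 0 ≤ bilinearExt (G.excess lam w) x y)
    (τ : BehaviorStrategy (I × J) J) : w ≤ G.discountedPayoff lam (.stationary _ x) τ := by
  have h := (G.hasSum_integral_excess (.stationary _ x) τ h0 h1 w).nonneg fun n =>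
    mul_nonneg (pow_nonneg (by linarith) n) (by
      rw [integral_playLaw _ _ _ (G.continuous_excess lam w)]
      exact integral_nonneg fun h => by simpa using hx _)
  linarith

lemma discountedPayoff_stationary_le {lam : ℝ} (h0 : 0 < lam) (h1 : lam ≤ 1) {w : ℝ}
    {y : ProbabilityMeasure J} (hy : ∀ x, bilinearExt (G.excess lam w) x y ≤ 0)
    (σ : BehaviorStrategy (I × J) I) : G.discountedPayoff lam σ (.stationary _ y) ≤ w := by
  have h := (G.hasSum_integral_excess σ (.stationary _ y) h0 h1 w).nonpos fun n =>
    mul_nonpos_of_nonneg_of_nonpos (pow_nonneg (by linarith) n) (by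
      rw [integral_playLaw _ _ _ (G.continuous_excess lam w)]
      exact integral_nonpos fun h => by simpa using hy _)
  linarith

lemma nonabsorbedProb_stationary (x : ProbabilityMeasure I) (y : ProbabilityMeasure J) (n : ℕ) :
    G.nonabsorbedProb (.stationary _ x) (.stationary _ y) n = (1 - bilinearExt G.ps x y) ^ n := by
  induction n with
  | zero => rw [nonabsorbedProb_zero, pow_zero]
  | succ n ih =>
    rw [nonabsorbedProb_succ, integral_playLaw_stationary _ G.continuous_ps, ih]
    ring

lemma stagePayoff_stationary (x : ProbabilityMeasure I) (y : ProbabilityMeasure J) (n : ℕ) :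
    G.stagePayoff (.stationary _ x) (.stationary _ y) n =
      (1 - bilinearExt G.ps x y) ^ n * bilinearExt G.g x y +
      (∑ m ∈ Finset.range n, (1 - bilinearExt G.ps x y) ^ m) * bilinearExt G.Gs x y := by
  rw [stagePayoff_eq, integral_playLaw_stationary _ G.continuous_g, Finset.sum_mul,
    nonabsorbedProb_stationary]
  congr 1
  refine Finset.sum_congr rfl fun m _ => ?_
  rw [integral_playLaw_stationary _ G.continuous_Gs, nonabsorbedProb_stationary]

/-! ### Existence of the value of the discounted game -/

section Value

variable [Nonempty I] [Nonempty J]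

/-- For each candidate value `w`, one of the players has a mixed action that is good in the one-shot
game with continuation payoff `w`; the value is the threshold at which the alternative switches. -/
lemma exists_isGameValue_discountedPayoff {lam : ℝ} (h0 : 0 < lam) (h1 : lam ≤ 1) :
    IsGameValue (G.discountedPayoff lam) (G.discountedValue lam) ∧
      (∀ w < G.discountedValue lam, ∃ x, ∀ y, 0 ≤ bilinearExt (G.excess lam w) x y) ∧
      ∀ w > G.discountedValue lam, ∃ y, ∀ x, bilinearExt (G.excess lam w) x y ≤ 0 := by
  obtain ⟨i₀⟩ := ‹Nonempty I›
  obtain ⟨j₀⟩ := ‹Nonempty J›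
  let S : Set ℝ := {w | ∃ x, ∀ y, 0 ≤ bilinearExt (G.excess lam w) x y}
  have hS : ∀ w ∈ S, w ≤ 1 := by
    rintro w ⟨x, hx⟩
    have h2 := G.le_discountedPayoff_stationary h0 h1 hx (.stationary _ (diracProba j₀))
    exact h2.trans (abs_le.1 (G.abs_discountedPayoff_le _ _ h0 h1)).2
  have hbdd : BddAbove S := ⟨1, hS⟩
  have hne : S.Nonempty := by
    refine ⟨-1, diracProba i₀, fun y => ?_⟩
    rw [bilinearExt_excess]
    have h2 := (abs_le.1 (G.abs_bilinearExt_g_le (diracProba i₀) y)).1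
    have h3 := (abs_le.1 (G.abs_bilinearExt_Gs_le (diracProba i₀) y)).1
    exact add_nonneg (mul_nonneg h0.le (by linarith)) (mul_nonneg (by linarith) (by linarith))
  have hlow : ∀ w < sSup S, ∃ x, ∀ y, 0 ≤ bilinearExt (G.excess lam w) x y := by
    intro w hw
    obtain ⟨w', ⟨x, hx⟩, hw'⟩ := exists_lt_of_lt_csSup hne hw
    exact ⟨x, fun y => (hx y).trans (bilinearExt_mono (G.continuous_excess _ _)
      (G.continuous_excess _ _) (fun i j => G.excess_antitone h0.le h1 i j hw'.le) x y)⟩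
  have hhigh : ∀ w > sSup S, ∃ y, ∀ x, bilinearExt (G.excess lam w) x y ≤ 0 := by
    intro w hw
    have : Nonempty I := ⟨i₀⟩
    rcases exists_forall_integral_pos_or_exists_forall_integral_nonpos
      (G.continuous_excess lam w) with ⟨x, hx⟩ | ⟨y, hy⟩
    · refine absurd (le_csSup hbdd (show w ∈ S from ⟨x, fun y => ?_⟩)) hw.not_ge
      rw [bilinearExt_eq_integral_integral_swap (G.continuous_excess lam w)]
      exact integral_nonneg fun j => (hx j).le
    · refine ⟨y, fun x => ?_⟩
      rw [bilinearExt_eq_integral_integral (G.continuous_excess lam w)]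
      exact integral_nonpos hy
  have hval : IsGameValue (G.discountedPayoff lam) (sSup S) := by
    intro ε hε
    obtain ⟨x, hx⟩ := hlow (sSup S - ε) (by linarith)
    obtain ⟨y, hy⟩ := hhigh (sSup S + ε) (by linarith)
    exact ⟨⟨_, G.le_discountedPayoff_stationary h0 h1 hx⟩,
      ⟨_, G.discountedPayoff_stationary_le h0 h1 hy⟩⟩
  have heq : G.discountedValue lam = sSup S :=
    hval.iSup_iInf_eq fun σ τ => G.abs_discountedPayoff_le σ τ h0 h1
  rw [heq]
  exact ⟨hval, hlow, hhigh⟩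

lemma abs_discountedValue_le {lam : ℝ} (h0 : 0 < lam) (h1 : lam ≤ 1) :
    |G.discountedValue lam| ≤ 1 := by
  have h := (G.exists_isGameValue_discountedPayoff h0 h1).1
  refine abs_le.2 ⟨le_of_forall_pos_le_add fun ε hε => ?_, le_of_forall_pos_le_add fun ε hε => ?_⟩
  · obtain ⟨⟨σ, -⟩, ⟨τ, hτ⟩⟩ := h ε hε
    exact (abs_le.1 (G.abs_discountedPayoff_le σ τ h0 h1)).1.trans (hτ σ)
  · obtain ⟨⟨σ, hσ⟩, ⟨τ, -⟩⟩ := h ε hε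
    linarith [hσ τ, (abs_le.1 (G.abs_discountedPayoff_le σ τ h0 h1)).2]

end Value

end AbsorbingGame

/-! ### The auxiliary game and the limit value -/

namespace AbsorbingGame

section General

variable {I J : Type*} [TopologicalSpace I] [MeasurableSpace I] [TopologicalSpace J]
  [MeasurableSpace J] (G : AbsorbingGame I J)

lemma auxPayoff_eq (s : ProbabilityMeasure I × ProbabilityMeasure I × ℝ≥0)
    (t : ProbabilityMeasure J × ProbabilityMeasure J × ℝ≥0) :
    G.auxPayoff s t = (bilinearExt G.g s.1 t.1 + s.2.2 * bilinearExt G.Gs s.2.1 t.1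
      + t.2.2 * bilinearExt G.Gs s.1 t.2.1) /
    (1 + s.2.2 * bilinearExt G.ps s.2.1 t.1 + t.2.2 * bilinearExt G.ps s.1 t.2.1) := rfl

end General

variable {I J : Type*} [MetricSpace I] [CompactSpace I] [MeasurableSpace I] [BorelSpace I]
  [MetricSpace J] [CompactSpace J] [MeasurableSpace J] [BorelSpace J] (G : AbsorbingGame I J)

lemma bilinearExt_swap_g (x : ProbabilityMeasure I) (y : ProbabilityMeasure J) :
    bilinearExt G.swap.g y x = -bilinearExt G.g x y := by
  rw [← bilinearExt_neg, ← bilinearExt_swap]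
  rfl

lemma bilinearExt_swap_ps (x : ProbabilityMeasure I) (y : ProbabilityMeasure J) :
    bilinearExt G.swap.ps y x = bilinearExt G.ps x y := by
  rw [← bilinearExt_swap]
  rfl

lemma bilinearExt_swap_Gs (x : ProbabilityMeasure I) (y : ProbabilityMeasure J) :
    bilinearExt G.swap.Gs y x = -bilinearExt G.Gs x y := by
  rw [← bilinearExt_neg, ← bilinearExt_swap]
  simp [Gs, swap]

lemma bilinearExt_swap_excess (lam w : ℝ) (x : ProbabilityMeasure I) (y : ProbabilityMeasure J) :
    bilinearExt (G.swap.excess lam (-w)) y x = -bilinearExt (G.excess lam w) x y := by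
  simp only [bilinearExt_excess, bilinearExt_swap_g, bilinearExt_swap_ps, bilinearExt_swap_Gs]
  ring

lemma auxPayoff_swap (s : ProbabilityMeasure I × ProbabilityMeasure I × ℝ≥0)
    (t : ProbabilityMeasure J × ProbabilityMeasure J × ℝ≥0) :
    G.swap.auxPayoff t s = -G.auxPayoff s t := by
  simp only [auxPayoff_eq, bilinearExt_swap_g, bilinearExt_swap_ps, bilinearExt_swap_Gs]
  rw [← neg_div]
  congr 1 <;> ring

lemma le_auxPayoff_iff (u : ℝ) (x x' : ProbabilityMeasure I) (a : ℝ≥0)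
    (y y' : ProbabilityMeasure J) (b : ℝ≥0) :
    u ≤ G.auxPayoff (x, x', a) (y, y', b) ↔ 0 ≤ bilinearExt G.g x y - u
      + a * (bilinearExt G.Gs x' y - u * bilinearExt G.ps x' y)
      + b * (bilinearExt G.Gs x y' - u * bilinearExt G.ps x y') := by
  have h1 := mul_nonneg a.2 (G.bilinearExt_ps_mem x' y).1
  have h2 := mul_nonneg b.2 (G.bilinearExt_ps_mem x y').1
  rw [auxPayoff_eq, le_div_iff₀ (by linarith!), ← sub_nonneg]
  ring_nf

lemma isEpsOptimalMin_auxPayoff_iff {v ε : ℝ}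
    {t : ProbabilityMeasure J × ProbabilityMeasure J × ℝ≥0} :
    IsEpsOptimalMin G.auxPayoff v ε t ↔ IsEpsOptimalMax G.swap.auxPayoff (-v) ε t := by
  refine forall_congr' fun s => ?_
  rw [auxPayoff_swap]
  constructor <;> intro h <;> linarith

/-- Let `u lam` be mixed actions of the maximizer that are good in the one-shot game with small
discount factor `lam` and continuation payoff `w lam`. If they converge to `x` and `w` to `v`, then
absorption by `x` is worth at least `v` whatever the opponent plays, and `x`, perturbed by
`u lam` with weight `(1 - lam) / lam`, guarantees almost `v` in the auxiliary game. -/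
lemma limit_of_bilinearExt_excess_nonneg {l : Filter ℝ} [l.NeBot] (hl : l ≤ 𝓝[>] 0)
    {u : ℝ → ProbabilityMeasure I} {x : ProbabilityMeasure I} (hu : Tendsto u l (𝓝 x))
    {w : ℝ → ℝ} {v : ℝ} (hw : Tendsto w l (𝓝 v))
    (h : ∀ᶠ lam in l, ∀ y, 0 ≤ bilinearExt (G.excess lam (w lam)) (u lam) y) :
    (∀ y, v * bilinearExt G.ps x y ≤ bilinearExt G.Gs x y) ∧
      ∀ ε : ℝ, 0 < ε → ∃ (x' : ProbabilityMeasure I) (a : ℝ≥0),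
        IsEpsOptimalMax G.auxPayoff v ε (x, x', a) := by
  have hlim : Tendsto (fun lam : ℝ => lam) l (𝓝 0) := hl.trans nhdsWithin_le_nhds
  have hone : ∀ᶠ lam : ℝ in l, lam ∈ Set.Ioo (0 : ℝ) 1 := hl (Ioo_mem_nhdsGT one_pos)
  have hB : ∀ {f : I → J → ℝ}, (Continuous fun q : I × J => f q.1 q.2) →
      ∀ y, Tendsto (fun lam => bilinearExt f (u lam) y) l (𝓝 (bilinearExt f x y)) := by
    intro f hf y
    have : Continuous fun x : ProbabilityMeasure I => bilinearExt f x y :=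
      (continuous_bilinearExt hf).comp (continuous_id.prodMk continuous_const)
    exact (this.tendsto x).comp hu
  have ha : ∀ y, v * bilinearExt G.ps x y ≤ bilinearExt G.Gs x y := by
    intro y
    have hT : Tendsto (fun lam => bilinearExt (G.excess lam (w lam)) (u lam) y) l
        (𝓝 (0 * (bilinearExt G.g x y - v) +
          (1 - 0) * (bilinearExt G.Gs x y - v * bilinearExt G.ps x y))) := by
      simp only [bilinearExt_excess]
      exact (hlim.mul ((hB G.continuous_g y).sub hw)).add ((hlim.const_sub 1).mul
        ((hB G.continuous_Gs y).sub (hw.mul (hB G.continuous_ps y))))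
    have := ge_of_tendsto hT (h.mono fun lam hlam => hlam y)
    linarith
  refine ⟨ha, fun ε hε => ?_⟩
  obtain ⟨lam, h1, ⟨h0, hlt⟩, hg, hw'⟩ := (h.and (hone.and
    ((eventually_forall_abs_bilinearExt_sub_le (f := G.g) G.continuous_g hu (half_pos hε)).and
      (Metric.tendsto_nhds.1 hw (ε / 2) (half_pos hε))))).exists
  rw [Real.dist_eq] at hw'
  refine ⟨u lam, ((1 - lam) / lam).toNNReal, ?_⟩
  rintro ⟨y, y', b⟩
  rw [le_auxPayoff_iff]
  have hex := h1 y
  rw [bilinearExt_excess] at hex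
  have hex' : 0 ≤ bilinearExt G.g (u lam) y - w lam + (1 - lam) / lam *
      (bilinearExt G.Gs (u lam) y - w lam * bilinearExt G.ps (u lam) y) := by
    have := div_nonneg hex h0.le
    rwa [add_div, mul_div_cancel_left₀ _ h0.ne', mul_div_right_comm] at this
  have e1 := (abs_le.1 (hg y)).2
  have e2 := (abs_lt.1 hw').1
  have e3 : (1 - lam) / lam * (bilinearExt G.Gs (u lam) y - w lam * bilinearExt G.ps (u lam) y) ≤
      (1 - lam) / lam *
        (bilinearExt G.Gs (u lam) y - (v - ε) * bilinearExt G.ps (u lam) y) := by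
    refine mul_le_mul_of_nonneg_left ?_ (div_nonneg (by linarith) h0.le)
    have := mul_le_mul_of_nonneg_right (show v - ε ≤ w lam by linarith)
      (G.bilinearExt_ps_mem (u lam) y).1
    linarith
  have e4 : 0 ≤ (b : ℝ) * (bilinearExt G.Gs x y' - (v - ε) * bilinearExt G.ps x y') := by
    refine mul_nonneg b.2 ?_
    have := mul_nonneg hε.le (G.bilinearExt_ps_mem x y').1
    linarith [ha y']
  rw [Real.coe_toNNReal _ (div_nonneg (by linarith) h0.le)]
  linarith

lemma limit_of_bilinearExt_excess_nonpos {l : Filter ℝ} [l.NeBot] (hl : l ≤ 𝓝[>] 0)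
    {u : ℝ → ProbabilityMeasure J} {y : ProbabilityMeasure J} (hu : Tendsto u l (𝓝 y))
    {w : ℝ → ℝ} {v : ℝ} (hw : Tendsto w l (𝓝 v))
    (h : ∀ᶠ lam in l, ∀ x, bilinearExt (G.excess lam (w lam)) x (u lam) ≤ 0) :
    (∀ x, bilinearExt G.Gs x y ≤ v * bilinearExt G.ps x y) ∧
      ∀ ε : ℝ, 0 < ε → ∃ (y' : ProbabilityMeasure J) (b : ℝ≥0),
        IsEpsOptimalMin G.auxPayoff v ε (y, y', b) := by
  obtain ⟨h1, h2⟩ := G.swap.limit_of_bilinearExt_excess_nonneg hl hu hw.neg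
    (h.mono fun lam hlam x => by rw [bilinearExt_swap_excess]; linarith [hlam x])
  refine ⟨fun x => ?_, fun ε hε => ?_⟩
  · have := h1 x
    rw [bilinearExt_swap_ps, bilinearExt_swap_Gs] at this
    linarith
  · obtain ⟨y', b, h3⟩ := h2 ε hε
    exact ⟨y', b, G.isEpsOptimalMin_auxPayoff_iff.2 h3⟩

variable [Nonempty I] [Nonempty J]

/-- The discounted values converge to the value of the auxiliary game, and limits of good mixed
actions are first components of good strategies of the auxiliary game. Any ultrafilter of discount
factors going to `0` produces such limits, and the value it produces is that of the auxiliary game,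
hence does not depend on the ultrafilter. -/
theorem exists_tendsto_discountedValue : ∃ (v : ℝ) (x : ProbabilityMeasure I)
    (y : ProbabilityMeasure J), Tendsto G.discountedValue (𝓝[>] 0) (𝓝 v) ∧
      IsGameValue G.auxPayoff v ∧
      (∀ y', v * bilinearExt G.ps x y' ≤ bilinearExt G.Gs x y') ∧
      (∀ x', bilinearExt G.Gs x' y ≤ v * bilinearExt G.ps x' y) ∧
      (∀ ε : ℝ, 0 < ε → ∃ (x' : ProbabilityMeasure I) (a : ℝ≥0),
        IsEpsOptimalMax G.auxPayoff v ε (x, x', a)) ∧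
      ∀ ε : ℝ, 0 < ε → ∃ (y' : ProbabilityMeasure J) (b : ℝ≥0),
        IsEpsOptimalMin G.auxPayoff v ε (y, y', b) := by
  have hone : ∀ᶠ lam : ℝ in 𝓝[>] 0, lam ∈ Set.Ioo (0 : ℝ) 1 := Ioo_mem_nhdsGT one_pos
  have hx : ∀ lam : ℝ, ∃ x, lam ∈ Set.Ioo (0 : ℝ) 1 →
      ∀ y, 0 ≤ bilinearExt (G.excess lam (G.discountedValue lam - lam)) x y := by
    intro lam
    by_cases hlam : lam ∈ Set.Ioo (0 : ℝ) 1
    · obtain ⟨x, hx⟩ := (G.exists_isGameValue_discountedPayoff hlam.1 hlam.2.le).2.1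
        (G.discountedValue lam - lam) (by linarith [hlam.1])
      exact ⟨x, fun _ => hx⟩
    · exact ⟨diracProba (Classical.arbitrary I), fun h => absurd h hlam⟩
  have hy : ∀ lam : ℝ, ∃ y, lam ∈ Set.Ioo (0 : ℝ) 1 →
      ∀ x, bilinearExt (G.excess lam (G.discountedValue lam + lam)) x y ≤ 0 := by
    intro lam
    by_cases hlam : lam ∈ Set.Ioo (0 : ℝ) 1
    · obtain ⟨y, hy⟩ := (G.exists_isGameValue_discountedPayoff hlam.1 hlam.2.le).2.2
        (G.discountedValue lam + lam) (by linarith [hlam.1])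
      exact ⟨y, fun _ => hy⟩
    · exact ⟨diracProba (Classical.arbitrary J), fun h => absurd h hlam⟩
  choose u hu using hx
  choose t ht using hy
  have key : ∀ U : Ultrafilter ℝ, (U : Filter ℝ) ≤ 𝓝[>] 0 →
      ∃ (v : ℝ) (x : ProbabilityMeasure I) (y : ProbabilityMeasure J),
      Tendsto G.discountedValue U (𝓝 v) ∧ IsGameValue G.auxPayoff v ∧
      (∀ y', v * bilinearExt G.ps x y' ≤ bilinearExt G.Gs x y') ∧
      (∀ x', bilinearExt G.Gs x' y ≤ v * bilinearExt G.ps x' y) ∧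
      (∀ ε : ℝ, 0 < ε → ∃ (x' : ProbabilityMeasure I) (a : ℝ≥0),
        IsEpsOptimalMax G.auxPayoff v ε (x, x', a)) ∧
      ∀ ε : ℝ, 0 < ε → ∃ (y' : ProbabilityMeasure J) (b : ℝ≥0),
        IsEpsOptimalMin G.auxPayoff v ε (y, y', b) := by
    intro U hU
    have hid : Tendsto (fun lam : ℝ => lam) U (𝓝 0) := hU.trans nhdsWithin_le_nhds
    obtain ⟨v, -, hv⟩ := isCompact_Icc.ultrafilter_le_nhds' (U.map G.discountedValue)
      (s := Set.Icc (-1) 1)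
      ((hone.filter_mono hU).mono fun lam hlam =>
        abs_le.1 (G.abs_discountedValue_le hlam.1 hlam.2.le))
    obtain ⟨x, -, hx⟩ := isCompact_univ.ultrafilter_le_nhds' (U.map u) univ_mem
    obtain ⟨y, -, hy⟩ := isCompact_univ.ultrafilter_le_nhds' (U.map t) univ_mem
    have hv : Tendsto G.discountedValue U (𝓝 v) := hv
    obtain ⟨hx1, hx2⟩ := G.limit_of_bilinearExt_excess_nonneg hU hx
      (w := fun lam => G.discountedValue lam - lam) (v := v) (by simpa using hv.sub hid)
      ((hone.filter_mono hU).mono hu)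
    obtain ⟨hy1, hy2⟩ := G.limit_of_bilinearExt_excess_nonpos hU hy
      (w := fun lam => G.discountedValue lam + lam) (v := v) (by simpa using hv.add hid)
      ((hone.filter_mono hU).mono ht)
    refine ⟨v, x, y, hv, fun ε hε => ?_, hx1, hy1, hx2, hy2⟩
    obtain ⟨x', a, h1⟩ := hx2 ε hε
    obtain ⟨y', b, h2⟩ := hy2 ε hε
    exact ⟨⟨_, h1⟩, ⟨_, h2⟩⟩
  obtain ⟨v, x, y, -, hv, h⟩ := key (Ultrafilter.of (𝓝[>] 0)) (Ultrafilter.of_le _)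
  refine ⟨v, x, y, tendsto_iff_ultrafilter _ _ _ |>.2 fun U hU => ?_, hv, h⟩
  obtain ⟨v', -, -, h1, h2, -⟩ := key U hU
  rwa [hv.unique h2]

end AbsorbingGame

/-! ### Trajectories -/

section Trajectory

lemma stageDate_le_one {lam : ℝ} (h1 : lam ≤ 1) (n : ℕ) : stageDate lam n ≤ 1 := by
  rw [stageDate_eq]
  linarith [pow_nonneg (sub_nonneg.2 h1) n]

lemma trajectory_weight_nonneg {lam : ℝ} (h0 : 0 < lam) (h1 : lam ≤ 1) (t : ℝ) (n : ℕ) :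
    0 ≤ min t (stageDate lam (n + 1)) - min t (stageDate lam n) :=
  sub_nonneg.2 (min_le_min_left _ (stageDate_mono h0.le h1 n.le_succ))

lemma trajectory_weight_le {lam : ℝ} (h0 : 0 < lam) (h1 : lam ≤ 1) (t : ℝ) (n : ℕ) :
    min t (stageDate lam (n + 1)) - min t (stageDate lam n) ≤ lam * (1 - lam) ^ n := by
  have h := mul_nonneg h0.le (pow_nonneg (sub_nonneg.2 h1) n)
  rw [stageDate_succ]
  rcases le_total t (stageDate lam n) with h2 | h2
  · rw [min_eq_left h2, min_eq_left (by linarith)]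
    linarith
  · rw [min_eq_right h2]
    linarith [min_le_right t (stageDate lam n + lam * (1 - lam) ^ n)]

/-- The stages fill the whole time interval. -/
lemma hasSum_trajectory_weight {lam : ℝ} (h0 : 0 < lam) (h1 : lam ≤ 1) {t : ℝ}
    (ht : t ∈ Set.Icc (0 : ℝ) 1) :
    HasSum (fun n => min t (stageDate lam (n + 1)) - min t (stageDate lam n)) t := by
  have ha : Summable fun n => t - min t (stageDate lam n) := by
    refine Summable.of_nonneg_of_le (fun n => sub_nonneg.2 (min_le_left _ _)) (fun n => ?_)
      (summable_discount h0 h1)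
    have h2 := pow_nonneg (sub_nonneg.2 h1) n
    rcases le_total t (stageDate lam n) with h3 | h3
    · rw [min_eq_left h3]
      linarith
    · rw [min_eq_right h3, stageDate_eq]
      linarith [ht.2]
  have h := hasSum_telescope ha
  simp only [sub_sub_sub_cancel_left] at h
  have hz : stageDate lam 0 = 0 := by simp [stageDate]
  rwa [hz, min_eq_right ht.1, sub_zero] at h

/-- A trajectory is close to `t v`, uniformly in `t`, as soon as the discounted sum of the distances
between its stage quantities and `v` is small. -/
lemma abs_mul_sub_trajectory_le {lam : ℝ} (h0 : 0 < lam) (h1 : lam ≤ 1) {u d : ℕ → ℝ} {v D : ℝ}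
    (hud : ∀ n, |u n - v| ≤ d n) (hd : HasSum (fun n => lam * (1 - lam) ^ n * d n) D) {t : ℝ}
    (ht : t ∈ Set.Icc (0 : ℝ) 1) : |t * v - trajectory lam u t| ≤ D := by
  set c : ℕ → ℝ := fun n => min t (stageDate lam (n + 1)) - min t (stageDate lam n) with hc
  have hb : ∀ n, ‖c n * (u n - v)‖ ≤ lam * (1 - lam) ^ n * d n := by
    intro n
    rw [norm_mul, Real.norm_eq_abs, Real.norm_eq_abs,
      abs_of_nonneg (trajectory_weight_nonneg h0 h1 t n)]
    exact mul_le_mul (trajectory_weight_le h0 h1 t n) (hud n) (abs_nonneg _)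
      (mul_nonneg h0.le (pow_nonneg (sub_nonneg.2 h1) n))
  have hs := (Summable.of_norm_bounded hd.summable hb).hasSum
  have h := hs.add ((hasSum_trajectory_weight h0 h1 ht).mul_right v)
  have heq : trajectory lam u t = (∑' n, c n * (u n - v)) + t * v := by
    rw [trajectory, ← h.tsum_eq]
    refine tsum_congr fun n => ?_
    simp only [hc]
    ring
  rw [heq, sub_add_cancel_right, abs_neg]
  exact tsum_of_norm_bounded hd hb

/-- A nondecreasing function that is close to a trajectory at the dates is close to it
everywhere. -/
lemma abs_sub_trajectory_le_of_monotone {lam : ℝ} (h0 : 0 < lam) (h1 : lam ≤ 1) {u : ℕ → ℝ}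
    (hu : ∀ n, u n ∈ Set.Icc (0 : ℝ) 1) {f : ℝ → ℝ} (hf : MonotoneOn f (Set.Icc 0 1)) {δ : ℝ}
    (hdate : ∀ n, |f (stageDate lam n) - trajectory lam u (stageDate lam n)| ≤ δ)
    {t : ℝ} (ht : t ∈ Set.Ico (0 : ℝ) 1) : |f t - trajectory lam u t| ≤ δ + lam := by
  have hz : stageDate lam 0 = 0 := by simp [stageDate]
  have hex : ∃ n, t < stageDate lam n := by
    have hT : Tendsto (fun n => stageDate lam n) atTop (𝓝 1) := by
      simp only [stageDate_eq]
      simpa using (tendsto_pow_atTop_nhds_zero_of_norm_lt_one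
        (abs_one_sub_lt_one h0 h1)).const_sub 1
    exact (hT.eventually (lt_mem_nhds ht.2)).exists
  obtain ⟨n, hn⟩ : ∃ n, Nat.find hex = n + 1 := Nat.exists_eq_succ_of_ne_zero fun h => by
    have := Nat.find_spec hex
    rw [h, hz] at this
    exact absurd ht.1 this.not_ge
  have hlt : t < stageDate lam (n + 1) := hn ▸ Nat.find_spec hex
  have hle : stageDate lam n ≤ t := not_lt.1 (Nat.find_min hex (by omega))
  have hmem : ∀ m, stageDate lam m ∈ Set.Icc (0 : ℝ) 1 := fun m =>
    ⟨hz ▸ stageDate_mono h0.le h1 m.zero_le, stageDate_le_one h1 m⟩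
  have hcell := trajectory_of_mem_Icc h0.le h1 u n ⟨hle, hlt.le⟩
  have hcell' := trajectory_of_mem_Icc h0.le h1 u n
    (t := stageDate lam (n + 1)) ⟨hle.trans hlt.le, le_rfl⟩
  rw [← trajectory_stageDate h0.le h1] at hcell hcell'
  have hlen : stageDate lam (n + 1) - stageDate lam n ≤ lam := by
    rw [stageDate_succ, add_sub_cancel_left]
    exact mul_le_of_le_one_right h0.le (pow_le_one₀ (by linarith) (by linarith))
  have b1 : 0 ≤ (t - stageDate lam n) * u n := mul_nonneg (by linarith) (hu n).1
  have b2 : (t - stageDate lam n) * u n ≤ lam :=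
    (mul_le_of_le_one_right (by linarith) (hu n).2).trans (by linarith)
  have b3 : (stageDate lam (n + 1) - stageDate lam n) * u n ≤ lam :=
    (mul_le_of_le_one_right (by linarith) (hu n).2).trans hlen
  have m1 := hf (hmem n) ⟨ht.1, ht.2.le⟩ hle
  have m2 := hf ⟨ht.1, ht.2.le⟩ (hmem (n + 1)) hlt.le
  have d1 := abs_le.1 (hdate n)
  have d2 := abs_le.1 (hdate (n + 1))
  exact abs_le.2 ⟨by linarith [d1.1], by linarith [d2.2]⟩

lemma hasSum_discounted_geometric {lam p : ℝ} (h0 : 0 < lam) (h1 : lam ≤ 1)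
    (hp : p ∈ Set.Icc (0 : ℝ) 1) :
    HasSum (fun n => (1 - lam) ^ n * (1 - p) ^ n) (lam + (1 - lam) * p)⁻¹ := by
  have h : ‖(1 - lam) * (1 - p)‖ < 1 := by
    rw [norm_mul]
    refine mul_lt_one_of_nonneg_of_lt_one_left (norm_nonneg _) (abs_one_sub_lt_one h0 h1) ?_
    rw [Real.norm_eq_abs, abs_le]
    constructor <;> linarith [hp.1, hp.2]
  have := hasSum_geometric_of_norm_lt_one h
  rw [show 1 - (1 - lam) * (1 - p) = lam + (1 - lam) * p by ring] at this
  simpa only [mul_pow] using this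

lemma discount_add_absorption_pos {lam p : ℝ} (h0 : 0 < lam) (h1 : lam ≤ 1) (hp : 0 ≤ p) :
    0 < lam + (1 - lam) * p :=
  add_pos_of_pos_of_nonneg h0 (mul_nonneg (by linarith) hp)

lemma trajectory_pow_mem {lam p : ℝ} (h0 : 0 < lam) (h1 : lam ≤ 1) (hp : p ∈ Set.Icc (0 : ℝ) 1)
    {t : ℝ} : trajectory lam (fun n => (1 - p) ^ n) t ∈
      Set.Icc 0 (lam / (lam + (1 - lam) * p)) := by
  have hp' : 0 ≤ 1 - p := by linarith [hp.2]
  have hs := (hasSum_discounted_geometric h0 h1 hp).mul_left lam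
  have hle : ∀ n, (min t (stageDate lam (n + 1)) - min t (stageDate lam n)) * (1 - p) ^ n ≤
      lam * ((1 - lam) ^ n * (1 - p) ^ n) := fun n => by
    rw [← mul_assoc]
    exact mul_le_mul_of_nonneg_right (trajectory_weight_le h0 h1 t n) (pow_nonneg hp' n)
  have hnn : ∀ n, 0 ≤ (min t (stageDate lam (n + 1)) - min t (stageDate lam n)) * (1 - p) ^ n :=
    fun n => mul_nonneg (trajectory_weight_nonneg h0 h1 t n) (pow_nonneg hp' n)
  refine ⟨tsum_nonneg hnn, ?_⟩
  rw [div_eq_mul_inv, ← hs.tsum_eq]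
  exact (Summable.of_nonneg_of_le hnn hle hs.summable).tsum_le_tsum hle hs.summable

lemma trajectory_pow_one {lam p : ℝ} (h0 : 0 < lam) (h1 : lam ≤ 1) (hp : p ∈ Set.Icc (0 : ℝ) 1) :
    trajectory lam (fun n => (1 - p) ^ n) 1 = lam / (lam + (1 - lam) * p) := by
  rw [trajectory_one h1, div_eq_mul_inv,
    ← ((hasSum_discounted_geometric h0 h1 hp).mul_left lam).tsum_eq]
  exact tsum_congr fun n => by ring

lemma trajectory_pow_stageDate {lam p : ℝ} (h0 : 0 < lam) (h1 : lam ≤ 1)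
    (hp : p ∈ Set.Icc (0 : ℝ) 1) (n : ℕ) :
    trajectory lam (fun n => (1 - p) ^ n) (stageDate lam n) =
      lam / (lam + (1 - lam) * p) * (1 - ((1 - lam) * (1 - p)) ^ n) := by
  have hk := discount_add_absorption_pos h0 h1 hp.1
  have h := mul_neg_geom_sum ((1 - lam) * (1 - p)) n
  rw [show 1 - (1 - lam) * (1 - p) = lam + (1 - lam) * p by ring] at h
  rw [trajectory_stageDate h0.le h1, ← h]
  simp only [← mul_pow]
  field_simp

/-! ### The limit occupation -/

lemma limitOccupation_coe (γ : ℝ≥0) (t : ℝ) :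
    limitOccupation γ t = (1 - (1 - t) ^ (1 + (γ : ℝ))) / (1 + γ) := by
  simp [limitOccupation]

lemma limitOccupation_top (t : ℝ) : limitOccupation ∞ t = 0 := by
  simp [limitOccupation]

lemma limitOccupation_monotoneOn (γ : ℝ≥0) : MonotoneOn (limitOccupation γ) (Set.Icc 0 1) := by
  intro s hs t ht hst
  rw [limitOccupation_coe, limitOccupation_coe]
  have h := Real.rpow_le_rpow (sub_nonneg.2 ht.2) (sub_le_sub_left hst 1)
    (show (0 : ℝ) ≤ 1 + γ by positivity)
  gcongr

lemma abs_pow_sub_pow_le_div {r s : ℝ} (hr0 : 0 ≤ r) (hr1 : r < 1) (hs0 : 0 ≤ s) (hs1 : s ≤ 1)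
    (n : ℕ) : |s ^ n - r ^ n| ≤ |s - r| / (1 - r) := by
  rw [← Commute.geom_sum₂_mul (Commute.all s r) n, abs_mul, mul_comm, div_eq_mul_inv]
  refine mul_le_mul_of_nonneg_left ?_ (abs_nonneg _)
  rw [abs_of_nonneg (Finset.sum_nonneg fun i _ => by positivity)]
  calc ∑ i ∈ Finset.range n, s ^ i * r ^ (n - 1 - i)
      ≤ ∑ i ∈ Finset.range n, r ^ (n - 1 - i) := Finset.sum_le_sum fun i _ =>
        mul_le_of_le_one_left (by positivity) (pow_le_one₀ hs0 hs1)
    _ = ∑ i ∈ Finset.range n, r ^ i := Finset.sum_range_reflect _ _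
    _ ≤ (1 - r)⁻¹ := by
        rw [← tsum_geometric_of_lt_one hr0 hr1]
        exact (summable_geometric_of_lt_one hr0 hr1).sum_le_tsum _ fun i _ => by positivity

lemma tendsto_discount_ratio {p : ℝ → ℝ} {γ : ℝ≥0}
    (hγ : Tendsto (fun lam => p lam / lam) (𝓝[>] 0) (𝓝 γ)) :
    Tendsto (fun lam => lam / (lam + (1 - lam) * p lam)) (𝓝[>] 0) (𝓝 (1 / (1 + γ))) := by
  have hid : Tendsto (fun lam : ℝ => lam) (𝓝[>] 0) (𝓝 0) := nhdsWithin_le_nhds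
  have h : Tendsto (fun lam => 1 / (1 + (1 - lam) * (p lam / lam))) (𝓝[>] 0)
      (𝓝 (1 / (1 + (1 - 0) * γ))) :=
    tendsto_const_nhds.div (((hid.const_sub 1).mul hγ).const_add 1)
      (by rw [sub_zero, one_mul]; positivity)
  rw [sub_zero, one_mul] at h
  refine h.congr' (eventually_mem_nhdsWithin.mono fun lam hlam => ?_)
  have h0 : lam ≠ 0 := (Set.mem_Ioi.1 hlam).ne'
  change _ = lam / (lam + (1 - lam) * p lam)
  rw [show lam + (1 - lam) * p lam = lam * (1 + (1 - lam) * (p lam / lam)) by field_simp,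
    div_mul_eq_div_div, div_self h0]

/-- If the probability of absorption at each stage is `γ lam + o(lam)`, the occupation of the
nonabsorbing state converges uniformly: at the date `t_n` it is
`lam / κ * (1 - (1 - κ) ^ n)` with `κ ~ (1 + γ) lam`, to be compared with
`(1 - ((1 - lam) ^ (1 + γ)) ^ n) / (1 + γ)`. -/
lemma eventually_abs_limitOccupation_sub_le {p : ℝ → ℝ}
    (hp : ∀ᶠ lam in 𝓝[>] 0, p lam ∈ Set.Icc (0 : ℝ) 1) {γ : ℝ≥0}
    (hγ : Tendsto (fun lam => p lam / lam) (𝓝[>] 0) (𝓝 γ)) {ε : ℝ} (hε : 0 < ε) :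
    ∀ᶠ lam in 𝓝[>] 0, ∀ t ∈ Set.Icc (0 : ℝ) 1,
      |limitOccupation γ t - trajectory lam (fun n => (1 - p lam) ^ n) t| ≤ ε := by
  have hid : Tendsto (fun lam : ℝ => lam) (𝓝[>] 0) (𝓝 0) := nhdsWithin_le_nhds
  have hγ1 : (1 : ℝ) + γ ≠ 0 := by positivity
  have hK := tendsto_discount_ratio hγ
  have hS : Tendsto (fun lam : ℝ => (1 - (1 - lam) ^ (1 + (γ : ℝ))) / lam) (𝓝[>] 0)
      (𝓝 (1 + γ)) := by
    have hder : HasDerivAt (fun lam : ℝ => 1 - (1 - lam) ^ (1 + (γ : ℝ))) (1 + γ) 0 := by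
      have h := (((hasDerivAt_id (0 : ℝ)).const_sub 1).rpow_const (p := 1 + (γ : ℝ))
        (Or.inl (by simp))).const_sub 1
      simpa using h
    have h := (hasDerivAt_iff_tendsto_slope_zero.1 hder).mono_left
      (nhdsWithin_mono _ (show Set.Ioi (0 : ℝ) ⊆ {0}ᶜ from fun x hx => (Set.mem_Ioi.1 hx).ne'))
    refine h.congr fun lam => ?_
    simp [div_eq_inv_mul]
  have hbound : Tendsto (fun lam : ℝ => |1 / (1 + (γ : ℝ)) - lam / (lam + (1 - lam) * p lam)| +
      |1 - (1 - (1 - lam) ^ (1 + (γ : ℝ))) / lam * (lam / (lam + (1 - lam) * p lam))| + lam)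
      (𝓝[>] 0) (𝓝 (|1 / (1 + (γ : ℝ)) - 1 / (1 + γ)| + |1 - (1 + γ) * (1 / (1 + (γ : ℝ)))| + 0)) :=
    ((hK.const_sub _).abs.add ((hS.mul hK).const_sub 1).abs).add hid
  rw [sub_self, mul_one_div_cancel hγ1, sub_self, abs_zero, add_zero, add_zero] at hbound
  filter_upwards [hp, hbound.eventually (gt_mem_nhds hε), Ioo_mem_nhdsGT one_pos]
    with lam hp hb hlam t ht
  obtain ⟨h0, hlt⟩ := hlam
  have hk := discount_add_absorption_pos h0 hlt.le hp.1
  set κ := lam + (1 - lam) * p lam with hκ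
  have hr : (1 - lam) * (1 - p lam) = 1 - κ := by rw [hκ]; ring
  have hr0 : 0 ≤ 1 - κ := by
    rw [← hr]
    exact mul_nonneg (by linarith) (by linarith [hp.2])
  rcases ht.2.eq_or_lt with rfl | ht1
  · rw [trajectory_pow_one h0 hlt.le hp, limitOccupation_coe, sub_self,
      Real.zero_rpow hγ1, sub_zero]
    have := abs_nonneg (1 - (1 - (1 - lam) ^ (1 + (γ : ℝ))) / lam * (lam / κ))
    linarith
  · refine (abs_sub_trajectory_le_of_monotone h0 hlt.le (fun n => ?_)
      (limitOccupation_monotoneOn γ) (δ := |1 / (1 + (γ : ℝ)) - lam / κ| +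
        |1 - (1 - (1 - lam) ^ (1 + (γ : ℝ))) / lam * (lam / κ)|) (fun n => ?_)
      ⟨ht.1, ht1⟩).trans hb.le
    · exact ⟨pow_nonneg (by linarith [hp.2]) n,
        pow_le_one₀ (by linarith [hp.2]) (by linarith [hp.1])⟩
    · rw [trajectory_pow_stageDate h0 hlt.le hp, limitOccupation_coe, stageDate_eq, hr]
      set s := (1 - lam) ^ (1 + (γ : ℝ)) with hs
      have hs0 : 0 ≤ s := Real.rpow_nonneg (by linarith) _
      have hs1 : s ≤ 1 := Real.rpow_le_one (by linarith) (by linarith) (by positivity)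
      have hsn : (1 - (1 - (1 - lam) ^ n)) ^ (1 + (γ : ℝ)) = s ^ n := by
        rw [sub_sub_cancel, hs, Real.rpow_pow_comm (by linarith)]
      have hpow := abs_pow_sub_pow_le_div hr0 (by linarith) hs0 hs1 n
      rw [sub_sub_cancel] at hpow
      have e1 : |s - (1 - κ)| / κ = |1 - (1 - s) / lam * (lam / κ)| := by
        rw [← abs_of_pos hk, ← abs_div, abs_of_pos hk]
        congr 1
        field_simp
        ring
      have hsn1 : |1 - (1 - κ) ^ n| ≤ 1 := by
        have h3 := pow_nonneg hr0 n
        have h4 := pow_le_one₀ (n := n) hr0 (by linarith)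
        exact abs_le.2 ⟨by linarith, by linarith⟩
      rw [hsn, show (1 - s ^ n) / (1 + (γ : ℝ)) - lam / κ * (1 - (1 - κ) ^ n) =
        (1 / (1 + γ) - lam / κ) * (1 - (1 - κ) ^ n) - (s ^ n - (1 - κ) ^ n) * (1 / (1 + γ)) by ring]
      refine (abs_sub _ _).trans (add_le_add ?_ ?_)
      · rw [abs_mul]
        exact mul_le_of_le_one_right (abs_nonneg _) hsn1
      · rw [abs_mul, ← e1]
        refine (mul_le_of_le_one_right (abs_nonneg _) ?_).trans hpow
        rw [abs_of_nonneg (by positivity), div_le_one (by positivity)]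
        linarith [γ.2]

lemma tendsto_discount_ratio_zero {p : ℝ → ℝ}
    (hp : Tendsto (fun lam => p lam / lam) (𝓝[>] 0) atTop) :
    Tendsto (fun lam => lam / (lam + (1 - lam) * p lam)) (𝓝[>] 0) (𝓝 0) := by
  have hid : Tendsto (fun lam : ℝ => lam) (𝓝[>] 0) (𝓝 0) := nhdsWithin_le_nhds
  have h1 : Tendsto (fun lam : ℝ => 1 - lam) (𝓝[>] 0) (𝓝 1) := by simpa using hid.const_sub 1
  have h := (tendsto_atTop_add_const_left _ 1 (h1.pos_mul_atTop one_pos hp)).inv_tendsto_atTop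
  refine h.congr' (eventually_mem_nhdsWithin.mono fun lam hlam => ?_)
  have h0 : lam ≠ 0 := (Set.mem_Ioi.1 hlam).ne'
  change _ = lam / (lam + (1 - lam) * p lam)
  rw [show lam + (1 - lam) * p lam = lam * (1 + (1 - lam) * (p lam / lam)) by field_simp,
    div_mul_eq_div_div, div_self h0, one_div]
  rfl

lemma eventually_abs_limitOccupation_top_sub_le {p : ℝ → ℝ}
    (hp : ∀ᶠ lam in 𝓝[>] 0, p lam ∈ Set.Icc (0 : ℝ) 1)
    (hγ : Tendsto (fun lam => p lam / lam) (𝓝[>] 0) atTop) {ε : ℝ} (hε : 0 < ε) :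
    ∀ᶠ lam in 𝓝[>] 0, ∀ t ∈ Set.Icc (0 : ℝ) 1,
      |limitOccupation ∞ t - trajectory lam (fun n => (1 - p lam) ^ n) t| ≤ ε := by
  filter_upwards [hp, (tendsto_discount_ratio_zero hγ).eventually (gt_mem_nhds hε),
    Ioo_mem_nhdsGT one_pos] with lam hp hb hlam t ht
  have h := trajectory_pow_mem hlam.1 hlam.2.le hp (t := t)
  rw [limitOccupation_top, zero_sub, abs_neg, abs_of_nonneg h.1]
  exact h.2.trans hb.le

lemma abs_rpow_sub_rpow_le {u α β : ℝ} (hu0 : 0 ≤ u) (hu1 : u ≤ 1) (hα : 1 ≤ α) (hβ : 1 ≤ β) :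
    |u ^ α - u ^ β| ≤ |α - β| := by
  wlog h : α ≤ β generalizing α β
  · rw [abs_sub_comm, abs_sub_comm α]
    exact this hβ hα (le_of_not_ge h)
  rcases hu0.eq_or_lt with rfl | hu
  · rw [Real.zero_rpow (by linarith), Real.zero_rpow (by linarith)]
    simp
  have h1 : u ^ β ≤ u ^ α := Real.rpow_le_rpow_of_exponent_ge hu hu1 h
  rw [abs_of_nonneg (sub_nonneg.2 h1), abs_of_nonpos (sub_nonpos.2 h), neg_sub]
  -- `u ^ α - u ^ β ≤ - (β - α) u ^ α log u`, and `- u log u ≤ 1 - u`.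
  have h2 : 1 + (β - α) * Real.log u ≤ u ^ (β - α) := by
    rw [Real.rpow_def_of_pos hu]
    linarith [Real.add_one_le_exp (Real.log u * (β - α))]
  have h3 : u ^ β = u ^ α * u ^ (β - α) := by
    rw [← Real.rpow_add hu]
    congr 1
    ring
  have h4 : u ^ α ≤ u := by
    simpa using Real.rpow_le_rpow_of_exponent_ge hu hu1 hα
  have h5 : -Real.log u ≤ u⁻¹ - 1 := by
    have := Real.log_le_sub_one_of_pos (inv_pos.2 hu)
    rwa [Real.log_inv] at this
  have h6 : 0 ≤ -Real.log u := neg_nonneg.2 (Real.log_nonpos hu0 hu1)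
  have h7 : u ^ α * -Real.log u ≤ 1 := by
    calc u ^ α * -Real.log u ≤ u * (u⁻¹ - 1) := mul_le_mul h4 h5 h6 hu0
      _ = 1 - u := by rw [mul_sub, mul_inv_cancel₀ hu.ne', mul_one]
      _ ≤ 1 := by linarith
  have h8 : 0 ≤ u ^ α := Real.rpow_nonneg hu0 _
  calc u ^ α - u ^ β = u ^ α * (1 - u ^ (β - α)) := by rw [h3]; ring
    _ ≤ u ^ α * ((β - α) * -Real.log u) := mul_le_mul_of_nonneg_left (by linarith) h8
    _ = (β - α) * (u ^ α * -Real.log u) := by ring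
    _ ≤ (β - α) * 1 := mul_le_mul_of_nonneg_left h7 (by linarith)
    _ = β - α := mul_one _

/-- The limit occupation depends continuously on `γ`, uniformly in time, at `γ = ∞` too. -/
lemma eventually_abs_limitOccupation_sub_limitOccupation_le (γ : ℝ≥0∞) {ε : ℝ} (hε : 0 < ε) :
    ∀ᶠ γ' in 𝓝 γ, ∀ t ∈ Set.Icc (0 : ℝ) 1, |limitOccupation γ t - limitOccupation γ' t| ≤ ε := by
  induction γ with
  | top =>
    filter_upwards [lt_mem_nhds (ENNReal.ofReal_lt_top (r := 1 / ε))] with γ' hγ' t ht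
    induction γ' with
    | top => simpa using hε.le
    | coe c =>
      have hc : 1 / ε < c := by
        rw [ENNReal.ofReal, ENNReal.coe_lt_coe] at hγ'
        exact (Real.le_coe_toNNReal _).trans_lt (NNReal.coe_lt_coe.2 hγ')
      have h1 := Real.rpow_nonneg (sub_nonneg.2 ht.2) (1 + (c : ℝ))
      have h2 := Real.rpow_le_one (sub_nonneg.2 ht.2) (sub_le_self 1 ht.1)
        (show (0 : ℝ) ≤ 1 + c by positivity)
      rw [limitOccupation_top, limitOccupation_coe, zero_sub, abs_neg,
        abs_of_nonneg (div_nonneg (by linarith) (by positivity)), div_le_iff₀ (by positivity)]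
      rw [div_lt_iff₀ hε] at hc
      linarith
  | coe c =>
    have hcont : Tendsto (fun c' : ℝ≥0 => |(c : ℝ) - c'| + |1 / (1 + (c : ℝ)) - 1 / (1 + c')|)
        (𝓝 c) (𝓝 (|(c : ℝ) - c| + |1 / (1 + (c : ℝ)) - 1 / (1 + c)|)) := by
      have h : Tendsto (fun c' : ℝ≥0 => (c' : ℝ)) (𝓝 c) (𝓝 c) :=
        NNReal.continuous_coe.tendsto c
      exact (h.const_sub _).abs.add
        ((tendsto_const_nhds.div (h.const_add 1) (by positivity)).const_sub _).abs
    simp only [sub_self, abs_zero, add_zero] at hcont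
    rw [ENNReal.nhds_coe, eventually_map]
    filter_upwards [hcont.eventually (gt_mem_nhds hε)] with c' hc' t ht
    have h1 := Real.rpow_nonneg (sub_nonneg.2 ht.2) (1 + (c' : ℝ))
    have h2 := Real.rpow_le_one (sub_nonneg.2 ht.2) (sub_le_self 1 ht.1)
      (show (0 : ℝ) ≤ 1 + c' by positivity)
    have h3 := abs_rpow_sub_rpow_le (sub_nonneg.2 ht.2) (sub_le_self 1 ht.1)
      (show (1 : ℝ) ≤ 1 + c' by simp) (show (1 : ℝ) ≤ 1 + c by simp)
    rw [show 1 + (c' : ℝ) - (1 + c) = -(c - c') by ring, abs_neg] at h3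
    rw [limitOccupation_coe, limitOccupation_coe]
    rw [show (1 - (1 - t) ^ (1 + (c : ℝ))) / (1 + c) - (1 - (1 - t) ^ (1 + (c' : ℝ))) / (1 + c') =
      ((1 - t) ^ (1 + (c' : ℝ)) - (1 - t) ^ (1 + (c : ℝ))) * (1 / (1 + c)) +
      (1 / (1 + c) - 1 / (1 + c')) * (1 - (1 - t) ^ (1 + (c' : ℝ))) by ring]
    refine (abs_add_le _ _).trans ((add_le_add ?_ ?_).trans hc'.le)
    · rw [abs_mul]
      refine (mul_le_of_le_one_right (abs_nonneg _) ?_).trans h3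
      rw [abs_of_nonneg (by positivity), div_le_one (by positivity)]
      linarith [c.2]
    · rw [abs_mul]
      exact mul_le_of_le_one_right (abs_nonneg _) (abs_le.2 ⟨by linarith, by linarith⟩)

end Trajectory

/-! ### Asymptotics of the perturbed stationary strategies -/

namespace AbsorbingGame

variable {I J : Type*} [MetricSpace I] [CompactSpace I] [MeasurableSpace I] [BorelSpace I]
  [MetricSpace J] [CompactSpace J] [MeasurableSpace J] [BorelSpace J] (G : AbsorbingGame I J)

lemma bilinearExt_hatStrategy_left {f : I → J → ℝ} (hf : Continuous fun q : I × J => f q.1 q.2)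
    (x x' : ProbabilityMeasure I) (a : ℝ≥0) (y : ProbabilityMeasure J) {lam : ℝ} (h0 : 0 ≤ lam) :
    (1 + lam * a) * bilinearExt f (hatStrategy x x' a lam) y =
      bilinearExt f x y + lam * a * bilinearExt f x' y := by
  simpa [hatStrategy, Real.coe_toNNReal _ h0] using
    bilinearExt_mixedCombination_left hf x x' (lam.toNNReal * a) y

lemma bilinearExt_hatStrategy_right {f : I → J → ℝ} (hf : Continuous fun q : I × J => f q.1 q.2)
    (x : ProbabilityMeasure I) (y y' : ProbabilityMeasure J) (b : ℝ≥0) {lam : ℝ} (h0 : 0 ≤ lam) :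
    (1 + lam * b) * bilinearExt f x (hatStrategy y y' b lam) =
      bilinearExt f x y + lam * b * bilinearExt f x y' := by
  simpa [hatStrategy, Real.coe_toNNReal _ h0] using
    bilinearExt_mixedCombination_right hf x (lam.toNNReal * b) y y'

lemma bilinearExt_hatStrategy {f : I → J → ℝ} (hf : Continuous fun q : I × J => f q.1 q.2)
    (x x' : ProbabilityMeasure I) (a : ℝ≥0) (y y' : ProbabilityMeasure J) (b : ℝ≥0) {lam : ℝ}
    (h0 : 0 ≤ lam) : bilinearExt f (hatStrategy x x' a lam) (hatStrategy y y' b lam) =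
      (bilinearExt f x y + lam * (a * bilinearExt f x' y + b * bilinearExt f x y' +
        lam * (a * b * bilinearExt f x' y'))) / ((1 + lam * a) * (1 + lam * b)) := by
  have h1 : (0 : ℝ) < 1 + lam * a := by positivity
  have h2 : (0 : ℝ) < 1 + lam * b := by positivity
  rw [eq_div_iff (by positivity)]
  have e1 := bilinearExt_hatStrategy_left hf x x' a (hatStrategy y y' b lam) h0
  have e2 := bilinearExt_hatStrategy_right hf x y y' b h0
  have e3 := bilinearExt_hatStrategy_right hf x' y y' b h0
  linear_combination (1 + lam * b) * e1 + e2 + lam * a * e3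

lemma tendsto_bilinearExt_hatStrategy {f : I → J → ℝ}
    (hf : Continuous fun q : I × J => f q.1 q.2) (x x' : ProbabilityMeasure I) (a : ℝ≥0)
    (y y' : ProbabilityMeasure J) (b : ℝ≥0) :
    Tendsto (fun lam => bilinearExt f (hatStrategy x x' a lam) (hatStrategy y y' b lam))
      (𝓝[>] 0) (𝓝 (bilinearExt f x y)) := by
  have h : ContinuousAt (fun lam : ℝ => (bilinearExt f x y + lam * (a * bilinearExt f x' y +
      b * bilinearExt f x y' + lam * (a * b * bilinearExt f x' y'))) /
        ((1 + lam * a) * (1 + lam * b))) 0 :=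
    ContinuousAt.div (by fun_prop) (by fun_prop) (by simp)
  have h' := h.tendsto.mono_left (nhdsWithin_le_nhds (s := Set.Ioi 0))
  simp only [zero_mul, add_zero, mul_one, div_one] at h'
  exact h'.congr' (eventually_mem_nhdsWithin.mono fun lam hlam =>
    (bilinearExt_hatStrategy hf x x' a y y' b (Set.mem_Ioi.1 hlam).le).symm)

/-- If `f` vanishes at the unperturbed actions, it is at most of order `lam` at the
perturbed ones. -/
lemma tendsto_bilinearExt_hatStrategy_div {f : I → J → ℝ}
    (hf : Continuous fun q : I × J => f q.1 q.2) {x : ProbabilityMeasure I}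
    {y : ProbabilityMeasure J} (hz : bilinearExt f x y = 0) (x' : ProbabilityMeasure I) (a : ℝ≥0)
    (y' : ProbabilityMeasure J) (b : ℝ≥0) :
    Tendsto (fun lam => bilinearExt f (hatStrategy x x' a lam) (hatStrategy y y' b lam) / lam)
      (𝓝[>] 0) (𝓝 (a * bilinearExt f x' y + b * bilinearExt f x y')) := by
  have h : ContinuousAt (fun lam : ℝ => (a * bilinearExt f x' y +
      b * bilinearExt f x y' + lam * (a * b * bilinearExt f x' y')) /
        ((1 + lam * a) * (1 + lam * b))) 0 :=
    ContinuousAt.div (by fun_prop) (by fun_prop) (by simp)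
  have h' := h.tendsto.mono_left (nhdsWithin_le_nhds (s := Set.Ioi 0))
  simp only [zero_mul, add_zero, mul_one, div_one] at h'
  refine h'.congr' (eventually_mem_nhdsWithin.mono fun lam hlam => ?_)
  have h0 : lam ≠ 0 := (Set.mem_Ioi.1 hlam).ne'
  change _ = bilinearExt f (hatStrategy x x' a lam) (hatStrategy y y' b lam) / lam
  rw [bilinearExt_hatStrategy hf x x' a y y' b (Set.mem_Ioi.1 hlam).le, hz, zero_add,
    mul_div_assoc, mul_div_cancel_left₀ _ h0]

/-- In the discounted game with factor `lam`, the perturbed action `hatStrategy x x' a lam` does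
against `y` almost what `(x, x', a)` does in the auxiliary game against
`(y, y, (1 - lam) / lam)`. -/
lemma eventually_bilinearExt_excess_hatStrategy_nonneg {v ε : ℝ} (hε : 0 < ε)
    {x x' : ProbabilityMeasure I} {a : ℝ≥0} (hopt : IsEpsOptimalMax G.auxPayoff v ε (x, x', a))
    {w : ℝ → ℝ} (hw : Tendsto w (𝓝[>] 0) (𝓝 v)) :
    ∀ᶠ lam in 𝓝[>] 0, ∀ y,
      0 ≤ bilinearExt (G.excess lam (w lam - 2 * ε)) (hatStrategy x x' a lam) y := by
  have hid : Tendsto (fun lam : ℝ => lam) (𝓝[>] 0) (𝓝 0) := nhdsWithin_le_nhds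
  have hsmall : Tendsto (fun lam => lam * (a * (2 + 2 * (1 + |w lam - 2 * ε|)))) (𝓝[>] 0)
      (𝓝 (0 * (a * (2 + 2 * (1 + |v - 2 * ε|))))) :=
    hid.mul ((((hw.sub_const _).abs.const_add 1).const_mul 2).const_add 2 |>.const_mul _)
  rw [zero_mul] at hsmall
  filter_upwards [hsmall.eventually (gt_mem_nhds (half_pos hε)), Ioo_mem_nhdsGT one_pos,
    Metric.tendsto_nhds.1 hw (ε / 2) (half_pos hε)] with lam hs ⟨h0, hlt⟩ hwv y
  rw [Real.dist_eq, abs_lt] at hwv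
  have hD : (0 : ℝ) < 1 + lam * a := by positivity
  set W := w lam - 2 * ε with hW
  rw [← mul_nonneg_iff_of_pos_left hD, bilinearExt_excess]
  have eg := bilinearExt_hatStrategy_left G.continuous_g x x' a y h0.le
  have eG := bilinearExt_hatStrategy_left G.continuous_Gs x x' a y h0.le
  have ep := bilinearExt_hatStrategy_left G.continuous_ps x x' a y h0.le
  have hA := hopt (y, y, ((1 - lam) / lam).toNNReal)
  rw [le_auxPayoff_iff, Real.coe_toNNReal _ (div_nonneg (by linarith) h0.le)] at hA
  have hA' : 0 ≤ lam * (bilinearExt G.g x y - (v - ε)) +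
      lam * a * (bilinearExt G.Gs x' y - (v - ε) * bilinearExt G.ps x' y) +
      (1 - lam) * (bilinearExt G.Gs x y - (v - ε) * bilinearExt G.ps x y) := by
    have := mul_nonneg h0.le hA
    have h3 : lam * ((1 - lam) / lam) = 1 - lam := mul_div_cancel₀ _ h0.ne'
    linear_combination this +
      (bilinearExt G.Gs x y - (v - ε) * bilinearExt G.ps x y) * h3
  -- The difference between the two payoffs is at least `lam` times `(v - ε - W) - ε / 2 ≥ 0`.
  have hp := G.bilinearExt_ps_mem x y
  have hp' := G.bilinearExt_ps_mem x' y
  have hg' := abs_le.1 (G.abs_bilinearExt_g_le x' y)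
  have hG' := abs_le.1 (G.abs_bilinearExt_Gs_le x' y)
  have hrem : -(2 + 2 * (1 + |W|)) ≤ bilinearExt G.g x' y - W -
      (bilinearExt G.Gs x' y - W * bilinearExt G.ps x' y) := by
    have h4 : |W * bilinearExt G.ps x' y| ≤ |W| := by
      rw [abs_mul, abs_of_nonneg hp'.1]
      exact mul_le_of_le_one_right (abs_nonneg _) hp'.2
    linarith [(abs_le.1 h4).1, le_abs_self W, abs_nonneg W, hp'.2, hG'.2, hg'.1]
  have huW : ε / 2 ≤ v - ε - W := by rw [hW]; linarith [hwv.2]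
  have k1 : 0 ≤ lam * (a * ((v - ε - W) * bilinearExt G.ps x' y)) :=
    mul_nonneg h0.le (mul_nonneg a.2 (mul_nonneg (by linarith) hp'.1))
  have k2 : 0 ≤ (1 - lam) * ((v - ε - W) * bilinearExt G.ps x y) :=
    mul_nonneg (by linarith) (mul_nonneg (by linarith) hp.1)
  have k3 : 0 ≤ lam * ((v - ε - W) + lam * a * (bilinearExt G.g x' y - W -
      (bilinearExt G.Gs x' y - W * bilinearExt G.ps x' y))) := by
    refine mul_nonneg h0.le ?_
    have := mul_le_mul_of_nonneg_left hrem (show 0 ≤ lam * (a : ℝ) by positivity)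
    linarith
  have e : (1 + lam * a) * (lam * (bilinearExt G.g (hatStrategy x x' a lam) y - W) + (1 - lam) *
      (bilinearExt G.Gs (hatStrategy x x' a lam) y -
        W * bilinearExt G.ps (hatStrategy x x' a lam) y)) =
      (lam * (bilinearExt G.g x y - (v - ε)) +
        lam * a * (bilinearExt G.Gs x' y - (v - ε) * bilinearExt G.ps x' y) +
        (1 - lam) * (bilinearExt G.Gs x y - (v - ε) * bilinearExt G.ps x y)) +
      lam * (a * ((v - ε - W) * bilinearExt G.ps x' y)) +
      (1 - lam) * ((v - ε - W) * bilinearExt G.ps x y) +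
      lam * ((v - ε - W) + lam * a * (bilinearExt G.g x' y - W -
        (bilinearExt G.Gs x' y - W * bilinearExt G.ps x' y))) := by
    linear_combination lam * eg + (1 - lam) * eG - (1 - lam) * W * ep
  rw [e]
  positivity

lemma eventually_hatStrategy_mem_epsOptimalStationary₁ {v ε : ℝ} (hε : 0 < ε)
    {x x' : ProbabilityMeasure I} {a : ℝ≥0} (hopt : IsEpsOptimalMax G.auxPayoff v ε (x, x', a))
    (hv : Tendsto G.discountedValue (𝓝[>] 0) (𝓝 v)) :
    ∀ᶠ lam in 𝓝[>] 0, hatStrategy x x' a lam ∈ G.EpsOptimalStationary₁ lam (2 * ε) := by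
  filter_upwards [G.eventually_bilinearExt_excess_hatStrategy_nonneg hε hopt hv,
    Ioo_mem_nhdsGT one_pos] with lam h hlam
  exact G.le_discountedPayoff_stationary hlam.1 hlam.2.le h

lemma eventually_hatStrategy_mem_epsOptimalStationary₂ {v ε : ℝ} (hε : 0 < ε)
    {y y' : ProbabilityMeasure J} {b : ℝ≥0} (hopt : IsEpsOptimalMin G.auxPayoff v ε (y, y', b))
    (hv : Tendsto G.discountedValue (𝓝[>] 0) (𝓝 v)) :
    ∀ᶠ lam in 𝓝[>] 0, hatStrategy y y' b lam ∈ G.EpsOptimalStationary₂ lam (2 * ε) := by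
  filter_upwards [G.swap.eventually_bilinearExt_excess_hatStrategy_nonneg hε
    (G.isEpsOptimalMin_auxPayoff_iff.1 hopt) hv.neg, Ioo_mem_nhdsGT one_pos] with lam h hlam
  refine G.discountedPayoff_stationary_le hlam.1 hlam.2.le fun x => ?_
  have := h x
  rw [show -G.discountedValue lam - 2 * ε = -(G.discountedValue lam + 2 * ε) by ring,
    bilinearExt_swap_excess] at this
  linarith

lemma occupationTrajectory_eq (lam : ℝ) (x : ProbabilityMeasure I) (y : ProbabilityMeasure J)
    (t : ℝ) : G.occupationTrajectory lam x y t =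
      trajectory lam (fun n => (1 - bilinearExt G.ps x y) ^ n) t := by
  rw [occupationTrajectory]
  congr 1
  exact funext (G.nonabsorbedProb_stationary x y)

/-- Under stationary strategies, the payoff `c` of a stage that is reached without absorption with
probability `q` satisfies `c - v = q (g - v) + s (G* - v p*)`, where `s` is the sum of these
probabilities over the earlier stages; the discounted sum of the absolute values bounds the distance
of the whole trajectory to `t v`. -/
lemma abs_mul_sub_payoffTrajectory_le {lam : ℝ} (h0 : 0 < lam) (h1 : lam ≤ 1) (v : ℝ)
    (x : ProbabilityMeasure I) (y : ProbabilityMeasure J) {t : ℝ} (ht : t ∈ Set.Icc (0 : ℝ) 1) :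
    |t * v - G.payoffTrajectory lam x y t| ≤
      lam / (lam + (1 - lam) * bilinearExt G.ps x y) * (|bilinearExt G.g x y - v| +
        (1 - lam) * |(bilinearExt G.Gs x y - v * bilinearExt G.ps x y) / lam|) := by
  set p := bilinearExt G.ps x y with hp
  have hpm : p ∈ Set.Icc (0 : ℝ) 1 := G.bilinearExt_ps_mem x y
  have hq0 : ∀ n, 0 ≤ (1 - p) ^ n := fun n => pow_nonneg (by linarith [hpm.2]) n
  have hq : ∀ n, |(1 - p) ^ n| ≤ 1 := fun n => by
    rw [abs_of_nonneg (hq0 n)]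
    exact pow_le_one₀ (by linarith [hpm.2]) (by linarith [hpm.1])
  have hgeo := hasSum_discounted_geometric h0 h1 hpm
  have hs := hasSum_discounted_sum_range h0 h1 hq
  have hs' : ∑' m, (1 - lam) ^ (m + 1) * (1 - p) ^ m =
      (1 - lam) * (lam + (1 - lam) * p)⁻¹ := by
    rw [← (hgeo.mul_left (1 - lam)).tsum_eq]
    exact tsum_congr fun m => by ring
  rw [hs'] at hs
  have hd := (hgeo.mul_left (lam * |bilinearExt G.g x y - v|)).add
    (hs.mul_left |bilinearExt G.Gs x y - v * p|)
  have hD : lam / (lam + (1 - lam) * p) * (|bilinearExt G.g x y - v| +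
      (1 - lam) * |(bilinearExt G.Gs x y - v * p) / lam|) =
      lam * |bilinearExt G.g x y - v| * (lam + (1 - lam) * p)⁻¹ +
      |bilinearExt G.Gs x y - v * p| * ((1 - lam) * (lam + (1 - lam) * p)⁻¹) := by
    rw [abs_div, abs_of_pos h0]
    field_simp
  rw [hD]
  refine abs_mul_sub_trajectory_le h0 h1 (d := fun n => (1 - p) ^ n * |bilinearExt G.g x y - v| +
    (∑ m ∈ Finset.range n, (1 - p) ^ m) * |bilinearExt G.Gs x y - v * p|) (fun n => ?_)
    (hd.congr_fun fun n => by ring) ht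
  have hgs : p * ∑ m ∈ Finset.range n, (1 - p) ^ m = 1 - (1 - p) ^ n := by
    have := mul_neg_geom_sum (1 - p) n
    rwa [sub_sub_cancel] at this
  rw [stagePayoff_stationary, ← hp]
  have hS : 0 ≤ ∑ m ∈ Finset.range n, (1 - p) ^ m := Finset.sum_nonneg fun m _ => hq0 m
  rw [show (1 - p) ^ n * bilinearExt G.g x y +
    (∑ m ∈ Finset.range n, (1 - p) ^ m) * bilinearExt G.Gs x y - v =
    (1 - p) ^ n * (bilinearExt G.g x y - v) +
      (∑ m ∈ Finset.range n, (1 - p) ^ m) * (bilinearExt G.Gs x y - v * p) by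
    linear_combination v * hgs]
  refine (abs_add_le _ _).trans (le_of_eq ?_)
  rw [abs_mul, abs_mul, abs_of_nonneg (hq0 n), abs_of_nonneg hS]

section Perturbation

variable {v ε : ℝ} {x x' : ProbabilityMeasure I} {a : ℝ≥0} {y y' : ProbabilityMeasure J} {b : ℝ≥0}

lemma tendsto_absorption_div_atTop (hp : 0 < bilinearExt G.ps x y) :
    Tendsto (fun lam => bilinearExt G.ps (hatStrategy x x' a lam) (hatStrategy y y' b lam) / lam)
      (𝓝[>] 0) atTop := by
  simp only [div_eq_mul_inv]
  exact (tendsto_bilinearExt_hatStrategy G.continuous_ps x x' a y y' b).pos_mul_atTop hp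
    tendsto_inv_nhdsGT_zero

/-- The perturbed stationary strategies make the occupation of the nonabsorbing state converge. The
parameter is the limit rate of absorption: infinite if `x` and `y` lead to absorption, and otherwise
due to each player's perturbation against the other's unperturbed action. -/
lemma exists_eventually_abs_limitOccupation_sub_le (x x' : ProbabilityMeasure I) (a : ℝ≥0)
    (y y' : ProbabilityMeasure J) (b : ℝ≥0) : ∃ γ : ℝ≥0∞, ∀ δ : ℝ, 0 < δ →
      ∀ᶠ lam in 𝓝[>] 0, ∀ t ∈ Set.Icc (0 : ℝ) 1, |limitOccupation γ t -
        G.occupationTrajectory lam (hatStrategy x x' a lam) (hatStrategy y y' b lam) t| ≤ δ := by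
  have hp : ∀ᶠ lam in 𝓝[>] (0 : ℝ), bilinearExt G.ps (hatStrategy x x' a lam)
      (hatStrategy y y' b lam) ∈ Set.Icc (0 : ℝ) 1 :=
    Eventually.of_forall fun lam => G.bilinearExt_ps_mem _ _
  simp only [occupationTrajectory_eq]
  rcases (G.bilinearExt_ps_mem x y).1.eq_or_lt with h | h
  · have hP : 0 ≤ a * bilinearExt G.ps x' y + b * bilinearExt G.ps x y' :=
      add_nonneg (mul_nonneg a.2 (G.bilinearExt_ps_mem _ _).1)
        (mul_nonneg b.2 (G.bilinearExt_ps_mem _ _).1)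
    refine ⟨(a * bilinearExt G.ps x' y + b * bilinearExt G.ps x y').toNNReal, fun δ hδ => ?_⟩
    refine eventually_abs_limitOccupation_sub_le hp ?_ hδ
    rw [Real.coe_toNNReal _ hP]
    exact tendsto_bilinearExt_hatStrategy_div G.continuous_ps h.symm x' a y' b
  · exact ⟨∞, fun δ hδ => eventually_abs_limitOccupation_top_sub_le hp
      (G.tendsto_absorption_div_atTop h) hδ⟩

/-- If `x`, `y` do not lead to absorption, the stage payoff and the payoff at absorption are both
close to `v`: each player can withdraw its own perturbation from the auxiliary game. -/
lemma abs_add_abs_le_of_epsOptimal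
    (hx : IsEpsOptimalMax G.auxPayoff v ε (x, x', a))
    (hy : IsEpsOptimalMin G.auxPayoff v ε (y, y', b))
    (hGx : ∀ y', v * bilinearExt G.ps x y' ≤ bilinearExt G.Gs x y')
    (hGy : ∀ x', bilinearExt G.Gs x' y ≤ v * bilinearExt G.ps x' y) (hε : 0 < ε) :
    |bilinearExt G.g x y - v| + |a * (bilinearExt G.Gs x' y - v * bilinearExt G.ps x' y) +
      b * (bilinearExt G.Gs x y' - v * bilinearExt G.ps x y')| ≤
    3 * ε * (1 + (a * bilinearExt G.ps x' y + b * bilinearExt G.ps x y')) := by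
  have hmin : ∀ z z' c, G.auxPayoff (z, z', c) (y, y', b) ≤ v + ε := fun z z' c => hy _
  have hmin' : ∀ z z' c, -v - ε ≤ G.swap.auxPayoff (y, y', b) (z, z', c) := fun z z' c => by
    rw [auxPayoff_swap]
    linarith [hmin z z' c]
  have h1 := hx (y, y', 0)
  have h2 := hx (y, y', b)
  have h3 := hmin' x x' 0
  have h4 := hmin' x x' a
  rw [le_auxPayoff_iff] at h1 h2 h3 h4
  simp only [bilinearExt_swap_g, bilinearExt_swap_ps, bilinearExt_swap_Gs, NNReal.coe_zero,
    zero_mul, add_zero] at h1 h3 h4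
  have p1 := mul_nonneg a.2 (G.bilinearExt_ps_mem x' y).1
  have p2 := mul_nonneg b.2 (G.bilinearExt_ps_mem x y').1
  change 0 ≤ (a : ℝ) * bilinearExt G.ps x' y at p1
  change 0 ≤ (b : ℝ) * bilinearExt G.ps x y' at p2
  have q1 := mul_nonneg hε.le p1
  have q2 := mul_nonneg hε.le p2
  have g1 := mul_le_mul_of_nonneg_left (hGy x') a.2
  have g2 := mul_le_mul_of_nonneg_left (hGx y') b.2
  change (a : ℝ) * _ ≤ (a : ℝ) * _ at g1
  change (b : ℝ) * _ ≤ (b : ℝ) * _ at g2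
  have hA : |bilinearExt G.g x y - v| ≤
      ε * (1 + (a * bilinearExt G.ps x' y + b * bilinearExt G.ps x y')) :=
    abs_le.2 ⟨by linarith, by linarith⟩
  have hB : |bilinearExt G.g x y - v +
      (a * (bilinearExt G.Gs x' y - v * bilinearExt G.ps x' y) +
        b * (bilinearExt G.Gs x y' - v * bilinearExt G.ps x y'))| ≤
      ε * (1 + (a * bilinearExt G.ps x' y + b * bilinearExt G.ps x y')) :=
    abs_le.2 ⟨by linarith, by linarith⟩
  have hC := abs_sub (bilinearExt G.g x y - v +
      (a * (bilinearExt G.Gs x' y - v * bilinearExt G.ps x' y) +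
        b * (bilinearExt G.Gs x y' - v * bilinearExt G.ps x y'))) (bilinearExt G.g x y - v)
  rw [add_sub_cancel_left] at hC
  linarith

lemma eventually_abs_mul_sub_payoffTrajectory_le
    (hx : IsEpsOptimalMax G.auxPayoff v ε (x, x', a))
    (hy : IsEpsOptimalMin G.auxPayoff v ε (y, y', b))
    (hGx : ∀ y', v * bilinearExt G.ps x y' ≤ bilinearExt G.Gs x y')
    (hGy : ∀ x', bilinearExt G.Gs x' y ≤ v * bilinearExt G.ps x' y) (hε : 0 < ε) :
    ∀ᶠ lam in 𝓝[>] 0, ∀ t ∈ Set.Icc (0 : ℝ) 1, |t * v -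
      G.payoffTrajectory lam (hatStrategy x x' a lam) (hatStrategy y y' b lam) t| ≤ 4 * ε := by
  have hid : Tendsto (fun lam : ℝ => lam) (𝓝[>] 0) (𝓝 0) := nhdsWithin_le_nhds
  have hE : ∀ x y, bilinearExt (fun i j => G.Gs i j - v * G.ps i j) x y =
      bilinearExt G.Gs x y - v * bilinearExt G.ps x y := fun x y => by
    rw [bilinearExt_sub G.continuous_Gs (G.continuous_ps.const_mul v), bilinearExt_const_mul]
  have hE0 : bilinearExt (fun i j => G.Gs i j - v * G.ps i j) x y = 0 := by
    rw [hE]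
    linarith [hGx y, hGy x]
  have hT := (tendsto_bilinearExt_hatStrategy G.continuous_g x x' a y y' b).sub_const v |>.abs.add
    ((hid.const_sub 1).mul (tendsto_bilinearExt_hatStrategy_div
      (G.continuous_Gs.sub (G.continuous_ps.const_mul v)) hE0 x' a y' b).abs)
  simp only [hE, sub_zero, one_mul] at hT
  have hlim : ∃ r, Tendsto (fun lam => lam / (lam + (1 - lam) *
      bilinearExt G.ps (hatStrategy x x' a lam) (hatStrategy y y' b lam))) (𝓝[>] 0) (𝓝 r) ∧
      r * (|bilinearExt G.g x y - v| +
        |a * (bilinearExt G.Gs x' y - v * bilinearExt G.ps x' y) +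
          b * (bilinearExt G.Gs x y' - v * bilinearExt G.ps x y')|) < 4 * ε := by
    rcases (G.bilinearExt_ps_mem x y).1.eq_or_lt with h | h
    · have hP : 0 ≤ a * bilinearExt G.ps x' y + b * bilinearExt G.ps x y' :=
        add_nonneg (mul_nonneg a.2 (G.bilinearExt_ps_mem _ _).1)
          (mul_nonneg b.2 (G.bilinearExt_ps_mem _ _).1)
      have hr := tendsto_bilinearExt_hatStrategy_div G.continuous_ps h.symm x' a y' b
      rw [← Real.coe_toNNReal _ hP] at hr
      refine ⟨_, tendsto_discount_ratio hr, ?_⟩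
      rw [Real.coe_toNNReal _ hP, one_div_mul_eq_div]
      refine ((div_le_iff₀ (by linarith)).2
        (G.abs_add_abs_le_of_epsOptimal hx hy hGx hGy hε)).trans_lt ?_
      linarith
    · exact ⟨0, tendsto_discount_ratio_zero (G.tendsto_absorption_div_atTop h), by
        rw [zero_mul]; linarith⟩
  obtain ⟨r, hr, hlt⟩ := hlim
  filter_upwards [(hr.mul hT).eventually (gt_mem_nhds hlt), Ioo_mem_nhdsGT one_pos]
    with lam hb hlam t ht
  exact (G.abs_mul_sub_payoffTrajectory_le hlam.1 hlam.2.le v _ _ ht).trans hb.le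

end Perturbation

end AbsorbingGame

lemma exists_lam_of_eventually {P : ℝ → Prop} (h : ∀ᶠ lam in 𝓝[>] (0 : ℝ), P lam) :
    ∃ lam₀ ∈ Set.Ioc (0 : ℝ) 1, ∀ lam ∈ Set.Ioo 0 lam₀, P lam := by
  obtain ⟨u, hu, hP⟩ := mem_nhdsGT_iff_exists_Ioo_subset.1 h
  exact ⟨min u 1, ⟨lt_min hu one_pos, min_le_right _ _⟩,
    fun lam hlam => hP ⟨hlam.1, hlam.2.trans_le (min_le_left _ _)⟩⟩

theorem mainTheorem1 {I J : Type*}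
    [MetricSpace I] [CompactSpace I] [Nonempty I] [MeasurableSpace I] [BorelSpace I]
    [MetricSpace J] [CompactSpace J] [Nonempty J] [MeasurableSpace J] [BorelSpace J]
    (G : AbsorbingGame I J) :
    (∀ lam ∈ Set.Ioc (0 : ℝ) 1, IsGameValue (G.discountedPayoff lam) (G.discountedValue lam)) ∧
    ∃ (v : ℝ) (γ : ℝ≥0∞),
      Tendsto G.discountedValue (𝓝[>] 0) (𝓝 v) ∧
      IsGameValue G.auxPayoff v ∧
      G.IsLOTM (limitOccupation γ) ∧
      G.IsLOTP (fun t => t * v) ∧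
      ∃ (x : ProbabilityMeasure I) (y : ProbabilityMeasure J),
        ∀ ε : ℝ, 0 < ε → ∃ (x' : ProbabilityMeasure I) (a : ℝ≥0)
            (y' : ProbabilityMeasure J) (b : ℝ≥0),
          IsEpsOptimalMax G.auxPayoff v ε (x, x', a) ∧
          IsEpsOptimalMin G.auxPayoff v ε (y, y', b) ∧
          ∃ lam₀ ∈ Set.Ioc (0 : ℝ) 1, ∀ lam ∈ Set.Ioo 0 lam₀,
            hatStrategy x x' a lam ∈ G.EpsOptimalStationary₁ lam ε ∧
            hatStrategy y y' b lam ∈ G.EpsOptimalStationary₂ lam ε ∧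
            ∀ t ∈ Set.Icc (0 : ℝ) 1,
              |limitOccupation γ t - G.occupationTrajectory lam
                (hatStrategy x x' a lam) (hatStrategy y y' b lam) t| ≤ ε ∧
              |t * v - G.payoffTrajectory lam
                (hatStrategy x x' a lam) (hatStrategy y y' b lam) t| ≤ ε := by
  refine ⟨fun lam hlam => (G.exists_isGameValue_discountedPayoff hlam.1 hlam.2).1, ?_⟩
  obtain ⟨v, x, y, hv, hA, hGx, hGy, hx, hy⟩ := G.exists_tendsto_discountedValue
  have hpos : ∀ k : ℕ, (0 : ℝ) < 1 / (k + 1) := fun k => Nat.one_div_pos_of_nat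
  choose x' a hxa using fun k : ℕ => hx _ (hpos k)
  choose y' b hyb using fun k : ℕ => hy _ (hpos k)
  choose γ hγ using fun k : ℕ =>
    G.exists_eventually_abs_limitOccupation_sub_le x (x' k) (a k) y (y' k) (b k)
  -- The rate of absorption depends on the precision; `γlim` is a limit point of these rates.
  obtain ⟨γlim, hlim⟩ : ∃ γlim, MapClusterPt γlim atTop γ :=
    exists_clusterPt_of_compactSpace _
  have key : ∀ ε : ℝ, 0 < ε → ∃ (x' : ProbabilityMeasure I) (a : ℝ≥0)
      (y' : ProbabilityMeasure J) (b : ℝ≥0),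
      IsEpsOptimalMax G.auxPayoff v ε (x, x', a) ∧ IsEpsOptimalMin G.auxPayoff v ε (y, y', b) ∧
      ∃ lam₀ ∈ Set.Ioc (0 : ℝ) 1, ∀ lam ∈ Set.Ioo 0 lam₀,
        hatStrategy x x' a lam ∈ G.EpsOptimalStationary₁ lam ε ∧
        hatStrategy y y' b lam ∈ G.EpsOptimalStationary₂ lam ε ∧
        ∀ t ∈ Set.Icc (0 : ℝ) 1,
          |limitOccupation γlim t - G.occupationTrajectory lam
            (hatStrategy x x' a lam) (hatStrategy y y' b lam) t| ≤ ε ∧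
          |t * v - G.payoffTrajectory lam
            (hatStrategy x x' a lam) (hatStrategy y y' b lam) t| ≤ ε := by
    intro ε hε
    obtain ⟨k, hk, hkε⟩ := ((mapClusterPt_iff_frequently.1 hlim _
      (eventually_abs_limitOccupation_sub_limitOccupation_le γlim (half_pos hε))).and_eventually
      (tendsto_one_div_add_atTop_nhds_zero_nat.eventually
        (gt_mem_nhds (show 0 < ε / 4 by linarith)))).exists
    have h1 := G.eventually_hatStrategy_mem_epsOptimalStationary₁ (hpos k) (hxa k) hv
    have h2 := G.eventually_hatStrategy_mem_epsOptimalStationary₂ (hpos k) (hyb k) hv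
    have h3 := G.eventually_abs_mul_sub_payoffTrajectory_le (hxa k) (hyb k) hGx hGy (hpos k)
    refine ⟨x' k, a k, y' k, b k, fun s => ?_, fun s => ?_,
      exists_lam_of_eventually ?_⟩
    · linarith [hxa k s]
    · linarith [hyb k s]
    · filter_upwards [h1, h2, h3, hγ k (ε / 2) (half_pos hε)] with lam e1 e2 e3 e4
      refine ⟨fun τ => ?_, fun σ => ?_, fun t ht => ⟨?_, ?_⟩⟩
      · linarith [e1 τ]
      · linarith [e2 σ]
      · linarith [abs_sub_le (limitOccupation γlim t) (limitOccupation (γ k) t)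
          (G.occupationTrajectory lam (hatStrategy x (x' k) (a k) lam)
            (hatStrategy y (y' k) (b k) lam) t), hk t ht, e4 t ht]
      · linarith [e3 t ht]
  refine ⟨v, γlim, hv, hA, fun ε hε => ?_, fun ε hε => ?_, x, y, key⟩
  · obtain ⟨x', a, y', b, -, -, lam₀, h0, h⟩ := key ε hε
    exact ⟨lam₀, h0, fun lam hlam => ⟨_, (h lam hlam).1, _, (h lam hlam).2.1,
      fun t ht => ((h lam hlam).2.2 t ht).1⟩⟩
  · obtain ⟨x', a, y', b, -, -, lam₀, h0, h⟩ := key ε hε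
    exact ⟨lam₀, h0, fun lam hlam => ⟨_, (h lam hlam).1, _, (h lam hlam).2.1,
      fun t ht => ((h lam hlam).2.2 t ht).2⟩⟩
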